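/- Let $M$ be a complete, connected, non-orientable hyperbolic $3$-manifold of finite volume, let $M_+\to M$ be its orientation covering (the connected orientable two-sheeted covering of $M$, with the lifted hyperbolic structure), and let $\Gamma_+=\pi_1(M_+)$. Let $\mathrm{hol}_+\colon\Gamma_+\to \mathrm{PSL}(2,\mathbb C)\cong\mathrm{Isom}^+(\mathbb H^3)$ be the oriented holonomy of $M_+$, i.e. the holonomy representation for which a developing map $\widetilde{M_+}\to\mathbb H^3$ (a local isometry from the universal covering) is equivariant; for a fixed orientation of $M_+$ it is well defined up to conjugation in $\mathrm{PSL}(2,\mathbb C)$. Let $\overline{\mathrm{hol}_+}$ be its composition with the entrywise complex conjugation of $\mathrm{PSL}(2,\mathbb C)$. Then, for either choice of orientation, $$[\mathrm{hol}_+]\neq[\overline{\mathrm{hol}_+}]\quad\text{in}\quad \mathcal R(\Gamma_+,\mathrm{PSL}(2,\mathbb C))=\hom(\Gamma_+,\mathrm{PSL}(2,\mathbb C))/\mathrm{PSL}(2,\mathbb C),$$ that is, there is no $A\in\mathrm{PSL}(2,\mathbb C)$ with $A\,\mathrm{hol}_+(\gamma)\,A^{-1}=\overline{\mathrm{hol}_+(\gamma)}$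 for all $\gamma\in\Gamma_+$. -/

import Mathlib

open scoped MatrixGroups ComplexConjugate Topology ENNReal MeasureTheory

/-! ### Hyperbolic three-space -/

/-- Hyperbolic three-space in the upper half-space model `{(z, t) : z ∈ ℂ, t > 0}`. -/
@[ext]
structure HypSpace where
  z : ℂ
  t : ℝ
  t_pos : 0 < t

namespace HypSpace

noncomputable section

/-- The point `(z, t)` as a point of Euclidean three-space. -/
def toEucl (p : HypSpace) : WithLp 2 (ℂ × ℝ) := WithLp.toLp 2 (p.z, p.t)

/-- The Euclidean mirror image `(z, -t)` of the point `(z, t)`. -/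
def mirror (p : HypSpace) : WithLp 2 (ℂ × ℝ) := WithLp.toLp 2 (p.z, -p.t)

/-- The hyperbolic distance, `2 arsinh (|p - q| / (2 √(t s)))` for `p = (z, t)`, `q = (w, s)`
(compare `UpperHalfPlane.dist_eq`); equivalently
`cosh (dist p q) = 1 + (|z - w|² + (t - s)²) / (2 t s)`, see `HypSpace.cosh_dist`. -/
instance : Dist HypSpace where
  dist p q := 2 * Real.arsinh (√(‖p.z - q.z‖ ^ 2 + (p.t - q.t) ^ 2) / (2 * √(p.t * q.t)))

theorem dist_def (p q : HypSpace) : dist p q =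
    2 * Real.arsinh (√(‖p.z - q.z‖ ^ 2 + (p.t - q.t) ^ 2) / (2 * √(p.t * q.t))) := rfl

theorem dist_toEucl (p q : HypSpace) :
    dist p.toEucl q.toEucl = √(‖p.z - q.z‖ ^ 2 + (p.t - q.t) ^ 2) := by
  rw [WithLp.prod_dist_eq_of_L2]
  simp [toEucl, dist_eq_norm]

theorem dist_mirror (p q : HypSpace) :
    dist p.toEucl q.mirror = √(‖p.z - q.z‖ ^ 2 + (p.t + q.t) ^ 2) := by
  rw [WithLp.prod_dist_eq_of_L2]
  simp [toEucl, mirror, dist_eq_norm]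

theorem dist_eq (p q : HypSpace) :
    dist p q = 2 * Real.arsinh (dist p.toEucl q.toEucl / (2 * √(p.t * q.t))) := by
  rw [dist_toEucl, dist_def]

theorem sinh_half_dist (p q : HypSpace) :
    Real.sinh (dist p q / 2) = dist p.toEucl q.toEucl / (2 * √(p.t * q.t)) := by
  rw [dist_eq, mul_div_cancel_left₀ _ two_ne_zero, Real.sinh_arsinh]

theorem cosh_half_dist (p q : HypSpace) :
    Real.cosh (dist p q / 2) = dist p.toEucl q.mirror / (2 * √(p.t * q.t)) := by
  have hp := p.t_pos
  have hq := q.t_pos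
  rw [← sq_eq_sq₀ (Real.cosh_pos _).le (by positivity), Real.cosh_sq', sinh_half_dist, div_pow,
    div_pow, mul_pow, Real.sq_sqrt (by positivity), dist_toEucl, dist_mirror,
    Real.sq_sqrt (by positivity), Real.sq_sqrt (by positivity)]
  field_simp
  ring

theorem cosh_dist (p q : HypSpace) : Real.cosh (dist p q) =
    1 + (‖p.z - q.z‖ ^ 2 + (p.t - q.t) ^ 2) / (2 * p.t * q.t) := by
  have hp := p.t_pos
  have hq := q.t_pos
  have h : dist p q = 2 * (dist p q / 2) := by ring
  rw [h, Real.cosh_two_mul, Real.cosh_sq', sinh_half_dist, div_pow, mul_pow,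
    Real.sq_sqrt (by positivity), dist_toEucl, Real.sq_sqrt (by positivity)]
  field_simp
  ring

theorem sinh_half_dist_add_dist (a b c : HypSpace) : Real.sinh ((dist a b + dist b c) / 2) =
    (dist a.toEucl b.toEucl * dist c.toEucl b.mirror +
      dist b.toEucl c.toEucl * dist a.toEucl b.mirror) /
      (2 * √(a.t * c.t) * dist b.toEucl b.mirror) := by
  have ha := a.t_pos
  have hb := b.t_pos
  have hc := c.t_pos
  have h1 : dist b.toEucl b.mirror = 2 * b.t := by
    rw [dist_mirror]
    simp only [sub_self, norm_zero]
    rw [show (0 : ℝ) ^ 2 + (b.t + b.t) ^ 2 = (2 * b.t) ^ 2 by ring, Real.sqrt_sq (by positivity)]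
  have h2 : dist b.toEucl c.mirror = dist c.toEucl b.mirror := by
    rw [dist_mirror, dist_mirror, norm_sub_rev, add_comm b.t]
  rw [add_div, Real.sinh_add, sinh_half_dist, sinh_half_dist, cosh_half_dist, cosh_half_dist, h1,
    h2, Real.sqrt_mul ha.le, Real.sqrt_mul hb.le, Real.sqrt_mul ha.le]
  have hb' : b.t = √b.t * √b.t := (Real.mul_self_sqrt hb.le).symm
  have := Real.sqrt_pos.2 ha
  have := Real.sqrt_pos.2 hb
  have := Real.sqrt_pos.2 hc
  conv_rhs => rw [hb']
  field_simp

theorem dist_triangle' (a b c : HypSpace) : dist a c ≤ dist a b + dist b c := by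
  have hb := b.t_pos
  have ha := a.t_pos
  have hc := c.t_pos
  rw [← div_le_div_iff_of_pos_right (zero_lt_two' ℝ), ← Real.sinh_le_sinh, sinh_half_dist,
    sinh_half_dist_add_dist, div_mul_eq_div_div _ _ (dist _ _), le_div_iff₀, div_mul_eq_mul_div]
  · gcongr
    exact EuclideanGeometry.mul_dist_le_mul_dist_add_mul_dist a.toEucl b.toEucl c.toEucl b.mirror
  · rw [dist_mirror]
    apply Real.sqrt_pos.2
    positivity

instance : MetricSpace HypSpace where
  dist_self p := by simp [dist_def]
  dist_comm p q := by
    rw [dist_def, dist_def, norm_sub_rev, mul_comm p.t, ← neg_sub q.t p.t, neg_sq]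
  dist_triangle := dist_triangle'
  eq_of_dist_eq_zero {p q} h := by
    have hp := p.t_pos
    have hq := q.t_pos
    have h1 := cosh_dist p q
    rw [h, Real.cosh_zero] at h1
    have h2 : (‖p.z - q.z‖ ^ 2 + (p.t - q.t) ^ 2) / (2 * p.t * q.t) = 0 := by linarith
    rw [div_eq_zero_iff, or_iff_left (by positivity)] at h2
    have h3 : ‖p.z - q.z‖ ^ 2 = 0 := by nlinarith [sq_nonneg ‖p.z - q.z‖, sq_nonneg (p.t - q.t)]
    have h4 : (p.t - q.t) ^ 2 = 0 := by linarith
    ext1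
    · simpa [sub_eq_zero] using h3
    · simpa [sub_eq_zero] using h4

/-! ### The action of `PSL(2, ℂ)` by Poincaré extension -/

/-- The positive number `|c z + d|² + |c|² t²`. -/
def den (g : SL(2, ℂ)) (p : HypSpace) : ℝ :=
  ‖g.1 1 0 * p.z + g.1 1 1‖ ^ 2 + ‖g.1 1 0‖ ^ 2 * p.t ^ 2

theorem den_pos (g : SL(2, ℂ)) (p : HypSpace) : 0 < den g p := by
  have hp := p.t_pos
  unfold den
  by_cases hc : g.1 1 0 = 0
  · have hd : g.1 1 1 ≠ 0 := by
      intro hd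
      have := g.2
      rw [Matrix.det_fin_two, hc, hd] at this
      simp at this
    rw [hc]
    simp only [zero_mul, zero_add, norm_zero]
    positivity
  · have : 0 < ‖g.1 1 0‖ := norm_pos_iff.2 hc
    positivity

/-- The Poincaré extension to upper half-space of the Möbius transformation
`z ↦ (a z + b) / (c z + d)`. -/
instance : SMul SL(2, ℂ) HypSpace where
  smul g p :=
    { z := ((g.1 0 0 * p.z + g.1 0 1) * conj (g.1 1 0 * p.z + g.1 1 1) +
        g.1 0 0 * conj (g.1 1 0) * (p.t : ℂ) ^ 2) / (den g p : ℂ)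
      t := p.t / den g p
      t_pos := div_pos p.t_pos (den_pos g p) }

theorem smul_z (g : SL(2, ℂ)) (p : HypSpace) : (g • p).z =
    ((g.1 0 0 * p.z + g.1 0 1) * conj (g.1 1 0 * p.z + g.1 1 1) +
        g.1 0 0 * conj (g.1 1 0) * (p.t : ℂ) ^ 2) / (den g p : ℂ) := rfl

theorem smul_t (g : SL(2, ℂ)) (p : HypSpace) : (g • p).t = p.t / den g p := rfl

/-- The positive definite Hermitian matrix of determinant one that represents `(z, t)`. -/
def herm (p : HypSpace) : Matrix (Fin 2) (Fin 2) ℂ :=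
  !![(p.z * conj p.z + (p.t : ℂ) ^ 2) / (p.t : ℂ), p.z / (p.t : ℂ);
     conj p.z / (p.t : ℂ), 1 / (p.t : ℂ)]

theorem t_ne (p : HypSpace) : (p.t : ℂ) ≠ 0 := Complex.ofReal_ne_zero.2 p.t_pos.ne'

theorem herm_injective : Function.Injective herm := by
  intro p q h
  have h1 := congrFun (congrFun h 1) 1
  have h2 := congrFun (congrFun h 0) 1
  simp only [herm, Matrix.of_apply, Matrix.cons_val', Matrix.cons_val_zero, Matrix.cons_val_one,
    Matrix.cons_val_fin_one, one_div, inv_inj] at h1 h2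
  rw [h1, div_left_inj' (t_ne q)] at h2
  exact HypSpace.ext h2 (Complex.ofReal_injective h1)

theorem coe_den (g : SL(2, ℂ)) (p : HypSpace) : (den g p : ℂ) =
    (g.1 1 0 * p.z + g.1 1 1) * conj (g.1 1 0 * p.z + g.1 1 1) +
      g.1 1 0 * conj (g.1 1 0) * (p.t : ℂ) ^ 2 := by
  simp only [Complex.mul_conj, Complex.normSq_eq_norm_sq, den]
  push_cast
  ring

theorem herm_smul (g : SL(2, ℂ)) (p : HypSpace) :
    herm (g • p) = g.1 * herm p * g.1.conjTranspose := by
  have hD : (den g p : ℂ) ≠ 0 := Complex.ofReal_ne_zero.2 (den_pos g p).ne'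
  have ht := t_ne p
  have hdet := g.2
  rw [Matrix.det_fin_two] at hdet
  have hdet' := congrArg conj hdet
  have hDe := coe_den g p
  have hDc : conj (den g p : ℂ) = den g p := Complex.conj_ofReal _
  ext i j
  fin_cases i <;> fin_cases j <;>
  simp only [herm, smul_z, smul_t, Matrix.mul_apply, Fin.sum_univ_two, Matrix.of_apply,
    Matrix.cons_val', Matrix.cons_val_zero, Matrix.cons_val_one, Matrix.cons_val_fin_one,
    Matrix.conjTranspose_apply, Complex.ofReal_div, map_div₀, map_add, map_mul, map_pow,
    Complex.conj_conj, Complex.conj_ofReal, Fin.zero_eta, Fin.mk_one, RCLike.star_def,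
    map_sub, map_one] at hdet' hDe ⊢
  all_goals
    generalize (den g p : ℂ) = D at *
    generalize (p.t : ℂ) = t at *
    generalize p.z = z at *
    generalize g.1 0 0 = a at *
    generalize g.1 0 1 = b at *
    generalize g.1 1 0 = c at *
    generalize g.1 1 1 = d at *
    generalize conj a = a' at *
    generalize conj b = b' at *
    generalize conj c = c' at *
    generalize conj d = d' at *
    generalize conj z = z' at *
    field_simp
  · subst hDe
    linear_combination (-t ^ 2 * (a' * d' - b' * c')) * hdet - t ^ 2 * hdet'
  all_goals
    subst hDe
    ring

theorem trace_herm (p q : HypSpace) :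
    (herm p * (herm q).adjugate).trace = ((2 * Real.cosh (dist p q) : ℝ) : ℂ) := by
  have hp := t_ne p
  have hq := t_ne q
  have h : ((‖p.z - q.z‖ ^ 2 : ℝ) : ℂ) = (p.z - q.z) * (conj p.z - conj q.z) := by
    rw [← map_sub, Complex.mul_conj, Complex.normSq_eq_norm_sq]
  rw [cosh_dist, Complex.ofReal_mul, Complex.ofReal_add, Complex.ofReal_div, Complex.ofReal_add, h]
  simp only [herm, Matrix.adjugate_fin_two, Matrix.trace_fin_two, Matrix.mul_apply,
    Fin.sum_univ_two, Matrix.of_apply, Matrix.cons_val', Matrix.cons_val_zero,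
    Matrix.cons_val_one, Matrix.cons_val_fin_one]
  push_cast
  field_simp
  ring

instance : MulAction SL(2, ℂ) HypSpace where
  one_smul p := herm_injective (by rw [herm_smul]; simp)
  mul_smul g h p := herm_injective (by
    rw [herm_smul, herm_smul, herm_smul, Matrix.SpecialLinearGroup.coe_mul,
      Matrix.conjTranspose_mul]
    simp only [Matrix.mul_assoc])

instance : IsIsometricSMul SL(2, ℂ) HypSpace where
  isometry_smul g := by
    refine Isometry.of_dist_eq fun p q => ?_
    have h := trace_herm (g • p) (g • q)
    have hg' : (g.1.conjTranspose).det = 1 := by rw [Matrix.det_conjTranspose, g.2, star_one]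
    have h1 : g.1.conjTranspose * (g.1.conjTranspose).adjugate = 1 := by
      rw [Matrix.mul_adjugate, hg', one_smul]
    have h2 : (g.1).adjugate * g.1 = 1 := by rw [Matrix.adjugate_mul, g.2, one_smul]
    have h3 : herm (g • p) * (herm (g • q)).adjugate =
        g.1 * (herm p * (herm q).adjugate * (g.1).adjugate) := by
      rw [herm_smul, herm_smul, Matrix.adjugate_mul_distrib, Matrix.adjugate_mul_distrib]
      calc g.1 * herm p * g.1.conjTranspose *
            ((g.1.conjTranspose).adjugate * ((herm q).adjugate * (g.1).adjugate))
          = g.1 * herm p * (g.1.conjTranspose * (g.1.conjTranspose).adjugate) *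
            ((herm q).adjugate * (g.1).adjugate) := by simp only [Matrix.mul_assoc]
        _ = _ := by rw [h1]; simp only [Matrix.mul_assoc, Matrix.mul_one]
    rw [h3, Matrix.trace_mul_comm, Matrix.mul_assoc, h2, Matrix.mul_one, trace_herm] at h
    have h4 := Complex.ofReal_injective h
    exact (Real.cosh_strictMonoOn.injOn dist_nonneg dist_nonneg (by linarith)).symm

/-- Scalar matrices act trivially. -/
theorem center_le_ker : Subgroup.center SL(2, ℂ) ≤
    (MulAction.toPermHom SL(2, ℂ) HypSpace).ker := by
  intro g hg
  obtain ⟨r, hr, hg⟩ := Matrix.SpecialLinearGroup.mem_center_iff.1 hg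
  rw [MonoidHom.mem_ker]
  ext1 p
  apply herm_injective
  rw [MulAction.toPermHom_apply, MulAction.toPerm_apply, herm_smul, ← hg]
  have hr' : r * conj r = 1 := by
    have h1 : ‖r‖ ^ 2 = 1 := by rw [← norm_pow, ← norm_one (α := ℂ), ← hr, Fintype.card_fin]
    rw [Complex.mul_conj, Complex.normSq_eq_norm_sq, h1, Complex.ofReal_one]
  have h2 : (Matrix.scalar (Fin 2) r).conjTranspose = Matrix.scalar (Fin 2) (conj r) := by
    simp [Matrix.scalar_apply, Matrix.diagonal_conjTranspose]
  rw [h2, Matrix.mul_assoc, ← (Matrix.scalar_commute (conj r) (fun _ => mul_comm _ _) _).eq,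
    ← Matrix.mul_assoc, ← map_mul, hr', map_one, Matrix.one_mul]
  rfl

/-- The action of `PSL(2, ℂ)` on hyperbolic space. It identifies `PSL(2, ℂ)` with the group of
orientation-preserving isometries of hyperbolic space. -/
instance : MulAction PSL(2, ℂ) HypSpace :=
  MulAction.compHom HypSpace
    (QuotientGroup.lift (Subgroup.center SL(2, ℂ)) (MulAction.toPermHom SL(2, ℂ) HypSpace)
      center_le_ker)

theorem mk_smul (g : SL(2, ℂ)) (p : HypSpace) : (QuotientGroup.mk g : PSL(2, ℂ)) • p = g • p := rfl

end

end HypSpace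

/-! ### Complex conjugation and conjugacy classes of representations -/

/-- Entrywise complex conjugation on `SL(2, ℂ)`. -/
noncomputable def slConj : SL(2, ℂ) →* SL(2, ℂ) := Matrix.SpecialLinearGroup.map (starRingEnd ℂ)

theorem slConj_center : Subgroup.center SL(2, ℂ) ≤ (Subgroup.center SL(2, ℂ)).comap slConj := by
  intro g hg
  obtain ⟨r, hr, hg⟩ := Matrix.SpecialLinearGroup.mem_center_iff.1 hg
  refine Matrix.SpecialLinearGroup.mem_center_iff.2 ⟨conj r, by rw [← map_pow, hr, map_one], ?_⟩
  change _ = (g : Matrix (Fin 2) (Fin 2) ℂ).map (starRingEnd ℂ)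
  rw [← hg]
  simp [Matrix.scalar_apply, Matrix.diagonal_map]

/-- Complex conjugation on `PSL(2, ℂ)`. -/
noncomputable def pslConj : PSL(2, ℂ) →* PSL(2, ℂ) :=
  QuotientGroup.map _ _ slConj slConj_center

/-- Two representations are equivalent when an element of the target group conjugates one into
the other. -/
def repSetoid (Γ G : Type*) [Group Γ] [Group G] : Setoid (Γ →* G) where
  r ρ ρ' := ∃ A : G, ∀ γ : Γ, A * ρ γ * A⁻¹ = ρ' γ
  iseqv :=
    { refl := fun ρ => ⟨1, by simp⟩
      symm := fun {ρ ρ'} ⟨A, h⟩ => ⟨A⁻¹, fun γ => by rw [← h γ]; group⟩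
      trans := fun {ρ ρ' ρ''} ⟨A, h⟩ ⟨B, h'⟩ => ⟨B * A, fun γ => by rw [← h' γ, ← h γ]; group⟩ }

/-- The set `hom(Γ, G) / G` of conjugacy classes of representations of `Γ` in `G`. -/
def RepClasses (Γ G : Type*) [Group Γ] [Group G] : Type _ := Quotient (repSetoid Γ G)

/-- The conjugacy class of a representation. -/
def RepClasses.mk {Γ G : Type*} [Group Γ] [Group G] (ρ : Γ →* G) : RepClasses Γ G :=
  Quotient.mk (repSetoid Γ G) ρ

/-! ### Hyperbolic three-manifolds, orientations, holonomy -/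

section Manifold

variable {X : Type*} [MetricSpace X]

/-- `f` restricts to an isometry from the open set `U` onto an open subset of hyperbolic space. -/
structure IsHypChart (U : Set X) (f : X → HypSpace) : Prop where
  isOpen_source : IsOpen U
  isOpen_image : IsOpen (f '' U)
  dist_eq : ∀ x ∈ U, ∀ y ∈ U, dist (f x) (f y) = dist x y

/-- A metric space is a hyperbolic three-manifold if it is locally isometric to hyperbolic
three-space. The Riemannian distance of a hyperbolic metric is a distance of this kind. -/
def IsHypThreeManifold (X : Type*) [MetricSpace X] : Prop :=
  ∀ x : X, ∃ (U : Set X) (f : X → HypSpace), x ∈ U ∧ IsHypChart U f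

/-- A hyperbolic three-manifold is orientable if it has an atlas of isometric charts whose
changes of charts are restrictions of orientation-preserving isometries of hyperbolic space, that
is, of elements of `PSL(2, ℂ)`, near every point. -/
def IsHypOrientable (X : Type*) [MetricSpace X] : Prop :=
  ∃ 𝒜 : Set (Set X × (X → HypSpace)),
    (∀ c ∈ 𝒜, IsHypChart c.1 c.2) ∧
    (∀ x : X, ∃ c ∈ 𝒜, x ∈ c.1) ∧
    ∀ c ∈ 𝒜, ∀ c' ∈ 𝒜, ∀ x ∈ c.1 ∩ c'.1,
      ∃ g : PSL(2, ℂ), ∀ᶠ y in 𝓝 x, c'.2 y = g • c.2 y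

/-- A hyperbolic manifold has finite volume. The Hausdorff measure of dimension three is a
positive constant multiple of the Riemannian volume. -/
def HasFiniteVolume (X : Type*) [MetricSpace X] [MeasurableSpace X] [BorelSpace X] : Prop :=
  μH[3] (Set.univ : Set X) < ∞

/-- `p : N → M` is an orientation covering of the connected non-orientable hyperbolic manifold
`M`: a connected orientable two-sheeted covering, where `N` carries the lifted hyperbolic
structure. -/
structure IsOrientationCovering {N M : Type*} [MetricSpace N] [MetricSpace M] (p : N → M) :
    Prop where
  connected : ConnectedSpace N
  isCoveringMap : IsCoveringMap p
  two_sheeted : ∀ x : M, (p ⁻¹' {x}).ncard = 2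
  locally_isometric : ∀ x : N, ∃ r > 0, ∀ y ∈ Metric.ball x r, ∀ z ∈ Metric.ball x r,
    dist (p y) (p z) = dist y z
  orientable : IsHypOrientable N

/-- The universal covering of `X` is the set of pairs `(y, c)` where `c` is a homotopy class of
paths from the base point `x₀` to `y`. A developing map is a local isometry `D` from the universal
covering to hyperbolic space: every `y` has a ball around it such that, for each class `c` from
`x₀` to `y`, the map `D` is distance-preserving on the classes obtained from `c` by moving the end
point along paths inside the ball. -/
def IsDevelopingMap (x₀ : X) (D : (y : X) → Path.Homotopic.Quotient x₀ y → HypSpace) : Prop :=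
  ∀ y : X, ∃ r > 0, ∀ c : Path.Homotopic.Quotient x₀ y,
    ∀ (y₁ y₂ : X) (δ₁ : Path y y₁) (δ₂ : Path y y₂),
      Set.range δ₁ ⊆ Metric.ball y r → Set.range δ₂ ⊆ Metric.ball y r →
      dist (D y₁ (c.trans (Path.Homotopic.Quotient.mk δ₁)))
        (D y₂ (c.trans (Path.Homotopic.Quotient.mk δ₂))) = dist y₁ y₂

/-- `h` is an oriented holonomy (for one of the two orientations) of an orientable hyperbolic
three-manifold: some developing map `D` is equivariant with respect to `h`. The
inverse appears because the product `γ * γ'` in `FundamentalGroup X x₀` is the class of the loop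
`γ'` followed by `γ`. -/
def IsOrientedHolonomy (x₀ : X) (h : FundamentalGroup X x₀ →* PSL(2, ℂ)) : Prop :=
  ∃ D : (y : X) → Path.Homotopic.Quotient x₀ y → HypSpace, IsDevelopingMap x₀ D ∧
    ∀ (γ : FundamentalGroup X x₀) (y : X) (c : Path.Homotopic.Quotient x₀ y),
      D y ((FundamentalGroup.toPath γ).symm.trans c) = h γ • D y c

end Manifold

/-!
A matrix `A` that conjugates the holonomy `h` into its complex conjugate gives an
orientation-reversing isometry `σ = reflect ∘ A` of hyperbolic space that commutes with every
`h γ`. Such an isometry does not exist when the quotient has finite volume.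

The space `N` is the quotient of hyperbolic space by the holonomy group
(`IsDevelopingMap.exists_uniformization`). For this, the developing map is inverted on the universal
covering: Lipschitz paths lift through it because their lifts project to Lipschitz paths in the
complete space `M` (`IsDevelopingMap.exists_lift_dev`), and the lifts of Euclidean segments from a
base point form a continuous section (`IsDevelopingMap.exists_section`).

Since `σ` reverses orientation, it moves some point `ξ` of the sphere at infinity
(`HypSpace.exists_conj_entry_ne_zero`). Let `x` tend to `ξ` along a geodesic. If `h γ` moves `x` by
a small amount, it moves `σ x` by the same amount because it commutes with `σ`; hence it moves by a
small amount the summit `y` of the geodesic from `ξ` to `σ ξ`, near which the geodesic from `x`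
to `σ x` passes (`HypSpace.cosh_dist_smul_le`). By discreteness `h γ` is then trivial
(`exists_smul_eq_self_of_dist_lt`). So there is a radius `r` such that the `r`-balls around all
points `x` near `ξ` embed in the quotient. The displacement `dist x (σ x)` is invariant under the
holonomy group and tends to infinity as `x` tends to `ξ`, so infinitely many of these balls have
disjoint images (`exists_disjoint_embedded_balls`).

All these balls have the same positive three-dimensional Hausdorff measure, and the map to `M` is a
local isometry that is at most two-to-one on their union, so the volume of `M` is infinite
(`hausdorffMeasure_le_mul_of_locally_isometric`), a contradiction.
-/

/-! ### Metric topology of hyperbolic space -/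

namespace HypSpace

theorem norm_sub_sq_add (p q : HypSpace) : ‖p.z - q.z‖ ^ 2 + (p.t - q.t) ^ 2 =
    2 * p.t * q.t * (Real.cosh (dist p q) - 1) := by
  have hp := p.t_pos
  have hq := q.t_pos
  rw [cosh_dist]
  field_simp
  ring

theorem t_le_of_dist (p q : HypSpace) : p.t ≤ 2 * q.t * Real.cosh (dist p q) := by
  have hp := p.t_pos
  have hq := q.t_pos
  have h := norm_sub_sq_add p q
  by_contra! hc
  nlinarith [sq_nonneg ‖p.z - q.z‖, mul_pos hp hq, mul_lt_mul_of_pos_left hc hp, sq_nonneg q.t]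

/-- In coordinates, a hyperbolic ball is cut out by a Euclidean inequality: it is a Euclidean ball
whose centre lies above the hyperbolic centre. -/
theorem dist_lt_iff {p q : HypSpace} {r : ℝ} (hr : 0 < r) : dist p q < r ↔
    ‖p.z - q.z‖ ^ 2 + (p.t - q.t) ^ 2 - 2 * q.t * (Real.cosh r - 1) * p.t < 0 := by
  have hp := p.t_pos
  have hq := q.t_pos
  have h : dist p q < r ↔ Real.cosh (dist p q) < Real.cosh r := by
    rw [Real.cosh_lt_cosh, abs_of_nonneg dist_nonneg, abs_of_pos hr]
  rw [h, norm_sub_sq_add, ← sub_neg]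
  have hpq : 0 < 2 * p.t * q.t := by positivity
  constructor
  · intro h; nlinarith
  · intro h; nlinarith

/-- The open upper half-space in `ℂ × ℝ`. -/
def upperHalf : Set (ℂ × ℝ) := {q | 0 < q.2}

/-- The coordinates of a point of hyperbolic space. -/
def coords (p : HypSpace) : ℂ × ℝ := (p.z, p.t)

/-- The point of hyperbolic space with given coordinates. -/
def ofCoords (q : upperHalf) : HypSpace := ⟨q.1.1, q.1.2, q.2⟩

theorem continuous_ofCoords : Continuous ofCoords := by
  rw [continuous_iff_continuousAt]
  intro x
  rw [ContinuousAt, tendsto_iff_dist_tendsto_zero]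
  have hx : 0 < x.1.2 := x.2
  have h : ContinuousAt (fun y : upperHalf => 2 * Real.arsinh
      (√(‖y.1.1 - x.1.1‖ ^ 2 + (y.1.2 - x.1.2) ^ 2) / (2 * √(y.1.2 * x.1.2)))) x := by
    have : (2 * √(x.1.2 * x.1.2)) ≠ 0 := by positivity
    refine ContinuousAt.mul continuousAt_const (Real.continuous_arsinh.continuousAt.comp ?_)
    refine ContinuousAt.div ?_ ?_ this <;> fun_prop
  have h' := h.tendsto
  simpa [dist_def, ofCoords] using h'

theorem continuous_coords : Continuous coords := by
  rw [continuous_iff_continuousAt]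
  intro p
  have hp := p.t_pos
  -- on all of hyperbolic space the Euclidean distance to `p` is bounded by a function of `dist · p`
  have key : ∀ q : HypSpace, ‖q.z - p.z‖ ^ 2 + (q.t - p.t) ^ 2 ≤
      4 * p.t ^ 2 * Real.cosh (dist q p) * (Real.cosh (dist q p) - 1) := by
    intro q
    rw [norm_sub_sq_add]
    have h1 := t_le_of_dist q p
    have h2 : 0 ≤ Real.cosh (dist q p) - 1 := by linarith [Real.one_le_cosh (dist q p)]
    have := mul_le_mul_of_nonneg_right h1 (mul_nonneg (mul_nonneg two_pos.le hp.le) h2)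
    nlinarith
  have lim : Filter.Tendsto (fun q : HypSpace =>
      4 * p.t ^ 2 * Real.cosh (dist q p) * (Real.cosh (dist q p) - 1)) (𝓝 p) (𝓝 0) := by
    have : Continuous (fun q : HypSpace =>
        4 * p.t ^ 2 * Real.cosh (dist q p) * (Real.cosh (dist q p) - 1)) := by
      have := Real.continuous_cosh
      fun_prop
    simpa using this.tendsto p
  have lim' := (Real.continuous_sqrt.tendsto 0).comp lim
  rw [Real.sqrt_zero] at lim'
  rw [ContinuousAt, tendsto_iff_dist_tendsto_zero]
  refine squeeze_zero (fun _ => dist_nonneg) (fun q => ?_) lim'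
  simp only [coords, Prod.dist_eq, Function.comp]
  refine max_le ?_ ?_
  · rw [dist_eq_norm]
    exact Real.le_sqrt_of_sq_le (by nlinarith [key q, sq_nonneg (q.t - p.t)])
  · rw [Real.dist_eq]
    refine Real.le_sqrt_of_sq_le ?_
    rw [sq_abs]
    nlinarith [key q, sq_nonneg ‖q.z - p.z‖]

/-- Hyperbolic space is homeomorphic to the upper half of `ℂ × ℝ`. -/
def coordsHomeomorph : HypSpace ≃ₜ upperHalf where
  toFun p := ⟨coords p, p.t_pos⟩
  invFun := ofCoords
  left_inv _ := rfl
  right_inv _ := rfl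
  continuous_toFun := continuous_coords.subtype_mk _
  continuous_invFun := continuous_ofCoords

theorem convex_upperHalf : Convex ℝ upperHalf := by
  intro x hx y hy a b ha hb hab
  simp only [upperHalf, Set.mem_ofPred, Prod.snd_add, Prod.smul_snd, smul_eq_mul] at *
  rcases eq_or_lt_of_le ha with rfl | ha
  · have : b = 1 := by linarith
    subst this; simpa using hy
  · have := mul_pos ha hx
    have := mul_nonneg hb hy.le
    linarith

/-- The subsets of the upper half-space that describe hyperbolic balls in `dist_lt_iff` are convex. -/
theorem convex_coords_ball (w : ℂ) (s c : ℝ) :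
    Convex ℝ {q : ℂ × ℝ | 0 < q.2 ∧ ‖q.1 - w‖ ^ 2 + (q.2 - s) ^ 2 - c * q.2 < 0} := by
  refine convex_upperHalf.inter
    (t := {q : ℂ × ℝ | ‖q.1 - w‖ ^ 2 + (q.2 - s) ^ 2 - c * q.2 < 0}) ?_
  intro x hx y hy a b ha hb hab
  simp only [Set.mem_ofPred, Prod.snd_add, Prod.smul_snd, smul_eq_mul, Prod.fst_add,
    Prod.smul_fst] at *
  have hn : ‖a • x.1 + b • y.1 - w‖ ≤ a * ‖x.1 - w‖ + b * ‖y.1 - w‖ := by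
    have : a • x.1 + b • y.1 - w = a • (x.1 - w) + b • (y.1 - w) := by
      have hb' : b = 1 - a := by linarith
      subst hb'
      module
    rw [this]
    refine (norm_add_le _ _).trans ?_
    rw [norm_smul, norm_smul, Real.norm_of_nonneg ha, Real.norm_of_nonneg hb]
  have hb' : b = 1 - a := by linarith
  subst hb'
  set u := ‖x.1 - w‖
  set v := ‖y.1 - w‖
  have hsq : ‖a • x.1 + (1 - a) • y.1 - w‖ ^ 2 ≤ (a * u + (1 - a) * v) ^ 2 := by gcongr
  have h1 : (a * u + (1 - a) * v) ^ 2 = a * u ^ 2 + (1 - a) * v ^ 2 - a * (1 - a) * (u - v) ^ 2 := by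
    ring
  have h2 : (a * x.2 + (1 - a) * y.2 - s) ^ 2 =
      a * (x.2 - s) ^ 2 + (1 - a) * (y.2 - s) ^ 2 - a * (1 - a) * (x.2 - y.2) ^ 2 := by ring
  have h3 := mul_nonneg (mul_nonneg ha hb) (sq_nonneg (u - v))
  have h4 := mul_nonneg (mul_nonneg ha hb) (sq_nonneg (x.2 - y.2))
  rcases eq_or_lt_of_le ha with rfl | ha
  · simp at *; linarith
  · have := mul_neg_of_pos_of_neg ha hx
    have := mul_nonpos_of_nonneg_of_nonpos hb hy.le
    nlinarith

/-- Hyperbolic balls are contractible, since they are Euclidean balls in the upper half-space. -/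
theorem contractibleSpace_ball (p : HypSpace) {r : ℝ} (hr : 0 < r) :
    ContractibleSpace (Metric.ball p r) := by
  have h := (convex_coords_ball p.z p.t (2 * p.t * (Real.cosh r - 1))).contractibleSpace
    ⟨coords p, p.t_pos, by
      have := (dist_lt_iff (p := p) (q := p) hr).1 (by simpa using hr)
      simpa [coords] using this⟩
  let e : Metric.ball p r ≃ₜ {q : ℂ × ℝ | 0 < q.2 ∧
      ‖q.1 - p.z‖ ^ 2 + (q.2 - p.t) ^ 2 - 2 * p.t * (Real.cosh r - 1) * q.2 < 0} :=
    { toFun := fun x => ⟨coords x.1, x.1.t_pos, (dist_lt_iff hr).1 x.2⟩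
      invFun := fun q => ⟨ofCoords ⟨q.1, q.2.1⟩, (dist_lt_iff hr).2 q.2.2⟩
      left_inv := fun _ => rfl
      right_inv := fun _ => rfl
      continuous_toFun := (continuous_coords.comp continuous_subtype_val).subtype_mk _
      continuous_invFun := (continuous_ofCoords.comp
        (continuous_subtype_val.subtype_mk _)).subtype_mk _ }
  exact e.contractibleSpace

theorem isCompact_closedBall (p : HypSpace) (r : ℝ) : IsCompact (Metric.closedBall p r) := by
  have hp := p.t_pos
  set C := Real.cosh r
  have hC : 1 ≤ C := Real.one_le_cosh r
  -- a compact box of the upper half-space that contains the ball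
  let K : Set upperHalf := Subtype.val ⁻¹'
    (Metric.closedBall p.z (2 * p.t * C) ×ˢ Set.Icc (p.t / (2 * C)) (2 * p.t * C))
  have hK : IsCompact K := by
    refine (Topology.IsInducing.subtypeVal.isCompact_preimage_iff ?_).2 ?_
    · rintro ⟨z, t⟩ ⟨-, ht⟩
      refine ⟨⟨(z, t), lt_of_lt_of_le (by positivity) ht.1⟩, rfl⟩
    · exact (ProperSpace.isCompact_closedBall _ _).prod isCompact_Icc
  refine IsCompact.of_isClosed_subset (hK.image continuous_ofCoords) Metric.isClosed_closedBall ?_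
  intro q hq
  have hq' := q.t_pos
  rw [Metric.mem_closedBall] at hq
  have hd : Real.cosh (dist q p) ≤ C := by
    rw [Real.cosh_le_cosh, abs_of_nonneg dist_nonneg]
    exact hq.trans (le_abs_self r)
  have hd1 := Real.one_le_cosh (dist q p)
  have h1 : q.t ≤ 2 * p.t * C := (t_le_of_dist q p).trans (by gcongr)
  have h2 : p.t ≤ 2 * q.t * C := by
    have := t_le_of_dist p q
    rw [dist_comm] at this
    exact this.trans (by gcongr)
  refine ⟨⟨coords q, q.t_pos⟩, ⟨?_, ?_, h1⟩, rfl⟩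
  · rw [Metric.mem_closedBall, dist_eq_norm]
    refine abs_le_of_sq_le_sq' ?_ (by positivity) |>.2
    have h3 := norm_sub_sq_add q p
    have h4 : 2 * q.t * p.t * (Real.cosh (dist q p) - 1) ≤ 2 * (2 * p.t * C) * p.t * C := by
      gcongr
      linarith
    simp only [coords]
    nlinarith [sq_nonneg (q.t - p.t)]
  · change p.t / (2 * C) ≤ q.t
    rw [div_le_iff₀ (by positivity)]
    linarith

instance : ProperSpace HypSpace := ⟨isCompact_closedBall⟩

instance : SecondCountableTopology HypSpace := secondCountable_of_proper

noncomputable instance : MeasurableSpace HypSpace := borel HypSpace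

instance : BorelSpace HypSpace := ⟨rfl⟩

instance : Nonempty HypSpace := ⟨⟨0, 1, one_pos⟩⟩

instance : ContractibleSpace HypSpace :=
  have := convex_upperHalf.contractibleSpace ⟨(0, 1), one_pos (α := ℝ)⟩
  coordsHomeomorph.contractibleSpace

/-- The special linear matrix that maps `(0, 1)` to `p`. -/
noncomputable def translation (p : HypSpace) : SL(2, ℂ) :=
  ⟨!![((√p.t : ℝ) : ℂ), p.z / ((√p.t : ℝ) : ℂ); 0, 1 / ((√p.t : ℝ) : ℂ)], by
    have : ((√p.t : ℝ) : ℂ) ≠ 0 := Complex.ofReal_ne_zero.2 (Real.sqrt_pos.2 p.t_pos).ne'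
    rw [Matrix.det_fin_two]
    simp [this]⟩

theorem translation_smul (p : HypSpace) : translation p • (⟨0, 1, one_pos⟩ : HypSpace) = p := by
  have hp := p.t_pos
  have hs : 0 < √p.t := Real.sqrt_pos.2 hp
  have hs2 : ((√p.t : ℝ) : ℂ) ≠ 0 := Complex.ofReal_ne_zero.2 hs.ne'
  have hsq : ((√p.t : ℝ) : ℂ) ^ 2 = p.t := by rw [← Complex.ofReal_pow, Real.sq_sqrt hp.le]
  have hden : den (translation p) ⟨0, 1, one_pos⟩ = 1 / p.t := by
    simp [den, translation, Real.sq_sqrt hp.le]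
  ext1
  · rw [smul_z, hden]
    simp only [translation]
    simp
    field_simp
    rw [hsq]
  · rw [smul_t, hden]
    simp

theorem exists_smul_eq (p q : HypSpace) : ∃ g : SL(2, ℂ), g • p = q :=
  ⟨translation q * (translation p)⁻¹, by
    rw [mul_smul, inv_smul_eq_iff.2 (translation_smul p).symm, translation_smul]⟩

theorem dist_smul_smul (g : PSL(2, ℂ)) (p q : HypSpace) : dist (g • p) (g • q) = dist p q := by
  induction g using QuotientGroup.induction_on with
  | H g => exact dist_smul g p q

end HypSpace

/-! ### Isometric maps of balls -/

/-- A distance-preserving self-map of a compact metric space is surjective: the orbit of a point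
outside the image would be a sequence without convergent subsequence. -/
theorem Isometry.surjective_of_compactSpace {K : Type*} [MetricSpace K] [CompactSpace K]
    {f : K → K} (hf : Isometry f) : Function.Surjective f := by
  intro q
  by_contra hq
  have hcl : IsClosed (Set.range f) := (isCompact_range hf.continuous).isClosed
  obtain ⟨ε, hε, hball⟩ := Metric.isOpen_iff.1 hcl.isOpen_compl q hq
  have hiter : ∀ n, Isometry (f^[n]) := fun n => by
    induction n with
    | zero => exact isometry_id
    | succ n ih => rw [Function.iterate_succ]; exact ih.comp hf
  have hsep : ∀ m n : ℕ, m < n → ε ≤ dist (f^[m] q) (f^[n] q) := by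
    intro m n hmn
    obtain ⟨k, rfl⟩ := Nat.exists_eq_add_of_lt hmn
    rw [show m + k + 1 = m + (k + 1) by ring, Function.iterate_add_apply, (hiter m).dist_eq]
    by_contra! hc
    refine hball (Metric.mem_ball'.2 hc) ⟨f^[k] q, ?_⟩
    rw [Function.iterate_succ_apply']
  obtain ⟨a, -, φ, hφ, hlim⟩ := isCompact_univ.tendsto_subseq (x := fun n => f^[n] q)
    fun _ => Set.mem_univ _
  obtain ⟨n, hn⟩ := Metric.cauchySeq_iff.1 hlim.cauchySeq ε hε
  have h1 := hn n le_rfl (n + 1) n.le_succ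
  exact absurd (hsep _ _ (hφ n.lt_succ_self)) (not_le.2 h1)

/-- The ball of radius `r` around `y` is isometric to a ball of hyperbolic space. -/
def IsHypBall {X : Type*} [MetricSpace X] (y : X) (r : ℝ) : Prop :=
  ∃ f : X → HypSpace, Set.BijOn f (Metric.ball y r) (Metric.ball (f y) r) ∧
    ∀ u ∈ Metric.ball y r, ∀ v ∈ Metric.ball y r, dist (f u) (f v) = dist u v

section HypBall

variable {X : Type*} [MetricSpace X]

theorem IsHypThreeManifold.exists_isHypBall (hX : IsHypThreeManifold X) (y : X) :
    ∃ r₀ > 0, ∀ r, 0 < r → r ≤ r₀ → IsHypBall y r := by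
  obtain ⟨U, f, hy, hU⟩ := hX y
  obtain ⟨r₁, h₁, hb₁⟩ := Metric.isOpen_iff.1 hU.isOpen_source y hy
  obtain ⟨r₂, h₂, hb₂⟩ := Metric.isOpen_iff.1 hU.isOpen_image (f y) ⟨y, hy, rfl⟩
  refine ⟨min r₁ r₂, lt_min h₁ h₂, fun r hr hr' => ⟨f, ⟨?_, ?_, ?_⟩, ?_⟩⟩
  all_goals
    have hs : Metric.ball y r ⊆ U :=
      (Metric.ball_subset_ball (hr'.trans (min_le_left _ _))).trans hb₁
  · intro u hu
    rw [Metric.mem_ball, hU.dist_eq u (hs hu) y hy]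
    exact hu
  · intro u hu v hv huv
    rw [← dist_eq_zero, ← hU.dist_eq u (hs hu) v (hs hv), huv, dist_self]
  · intro b hb
    obtain ⟨u, hu, rfl⟩ := hb₂ (Metric.ball_subset_ball (hr'.trans (min_le_right _ _)) hb)
    refine ⟨u, ?_, rfl⟩
    rw [Metric.mem_ball, ← hU.dist_eq u hu y hy]
    exact hb
  · exact fun u hu v hv => hU.dist_eq u (hs hu) v (hs hv)

theorem IsHypBall.contractibleSpace {y : X} {r : ℝ} (h : IsHypBall y r) (hr : 0 < r) :
    ContractibleSpace (Metric.ball y r) := by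
  obtain ⟨f, hbij, hdist⟩ := h
  have := HypSpace.contractibleSpace_ball (f y) hr
  have hiso : Isometry (hbij.equiv f) :=
    Isometry.of_dist_eq fun u v => hdist u.1 u.2 v.1 v.2
  exact (IsometryEquiv.mk (hbij.equiv f) hiso).toHomeomorph.contractibleSpace

/-- A distance-preserving map from a hyperbolic ball to hyperbolic space maps it onto a ball:
on smaller closed balls it differs from a self-map of a compact space by isometries. -/
theorem IsHypBall.image_eq_ball {y : X} {r : ℝ} (h : IsHypBall y r) (hr : 0 < r)
    {Φ : X → HypSpace}
    (hΦ : ∀ u ∈ Metric.ball y r, ∀ v ∈ Metric.ball y r, dist (Φ u) (Φ v) = dist u v) :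
    Φ '' Metric.ball y r = Metric.ball (Φ y) r := by
  obtain ⟨f, hbij, hdist⟩ := h
  have hy : y ∈ Metric.ball y r := Metric.mem_ball_self hr
  refine Set.Subset.antisymm ?_ ?_
  · rintro _ ⟨u, hu, rfl⟩
    rw [Metric.mem_ball, hΦ u hu y hy]
    exact hu
  · intro b hb
    obtain ⟨g, hg⟩ := HypSpace.exists_smul_eq (Φ y) (f y)
    set ρ := dist b (Φ y) with hρ
    have hρr : ρ < r := hb
    have hsub : Metric.closedBall (f y) ρ ⊆ Metric.ball (f y) r :=
      Metric.closedBall_subset_ball hρr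
    have : CompactSpace (Metric.closedBall (f y) ρ) :=
      isCompact_iff_compactSpace.1 (HypSpace.isCompact_closedBall _ _)
    have : Nonempty X := ⟨y⟩
    have hsurj : ∀ u : HypSpace, u ∈ Metric.ball (f y) r → ∃ x, x ∈ Metric.ball y r ∧ f x = u :=
      hbij.surjOn
    choose! k hk hfk using hsurj
    have hkd : ∀ u ∈ Metric.closedBall (f y) ρ, ∀ v ∈ Metric.closedBall (f y) ρ,
        dist (g • Φ (k u)) (g • Φ (k v)) = dist u v := by
      intro u hu v hv
      rw [dist_smul, hΦ _ (hk u (hsub hu)) _ (hk v (hsub hv)),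
        ← hdist _ (hk u (hsub hu)) _ (hk v (hsub hv)), hfk u (hsub hu), hfk v (hsub hv)]
    have hρ0 : 0 ≤ ρ := dist_nonneg
    have hc : f y ∈ Metric.closedBall (f y) ρ := Metric.mem_closedBall_self hρ0
    have hkc : k (f y) = y :=
      hbij.injOn (hk _ (hsub hc)) hy (hfk _ (hsub hc))
    let F : Metric.closedBall (f y) ρ → Metric.closedBall (f y) ρ := fun u =>
      ⟨g • Φ (k u), by
        have := hkd u u.2 _ hc
        rw [hkc, hg] at this
        change _ ∈ _
        rw [Metric.mem_closedBall, this]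
        exact u.2⟩
    have hF : Isometry F := Isometry.of_dist_eq fun u v => hkd u u.2 v v.2
    obtain ⟨u, hu⟩ := hF.surjective_of_compactSpace ⟨g • b, by
      rw [Metric.mem_closedBall, ← hg, dist_smul]⟩
    have hu' : g • Φ (k u) = g • b := congrArg Subtype.val hu
    exact ⟨k u, hk _ (hsub u.2), MulAction.injective g hu'⟩

end HypBall

/-! ### The universal covering -/

/-- The universal covering of a space, as the set of homotopy classes of paths that start at the
base point. -/
structure UnivCover {X : Type*} [TopologicalSpace X] (x₀ : X) where
  /-- The end point of the path. -/
  pt : X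
  /-- The homotopy class of the path. -/
  cls : Path.Homotopic.Quotient x₀ pt

namespace UnivCover

open scoped unitInterval

section Basic

variable {X : Type*} [TopologicalSpace X] {x₀ : X}

/-- The class of the constant path. -/
def base (x₀ : X) : UnivCover x₀ := ⟨x₀, Path.Homotopic.Quotient.refl x₀⟩

/-- Extend a class of paths by a path that starts at its end point. -/
noncomputable def extend (ξ : UnivCover x₀) {y : X} (δ : Path ξ.pt y) : UnivCover x₀ :=
  ⟨y, ξ.cls.trans (Path.Homotopic.Quotient.mk δ)⟩

@[simp] theorem extend_refl (ξ : UnivCover x₀) : ξ.extend (Path.refl ξ.pt) = ξ := by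
  simp [extend]

theorem extend_congr (ξ : UnivCover x₀) {y y' : X} (δ : Path ξ.pt y) (δ' : Path ξ.pt y')
    (h : ∀ t, δ t = δ' t) : ξ.extend δ = ξ.extend δ' := by
  obtain rfl : y = y' := by rw [← δ.target, h, δ'.target]
  rw [Path.ext (funext h)]

theorem extend_eq_of_homotopic (ξ : UnivCover x₀) {y : X} {δ δ' : Path ξ.pt y}
    (h : δ.Homotopic δ') : ξ.extend δ = ξ.extend δ' := by
  rw [extend, extend, Path.Homotopic.Quotient.eq.2 h]

theorem extend_extend (ξ : UnivCover x₀) {y z : X} (δ : Path ξ.pt y) (ε : Path y z) :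
    (ξ.extend δ).extend (y := z) ε = ξ.extend (δ.trans ε) := by
  simp only [extend, Path.Homotopic.Quotient.trans_assoc, Path.Homotopic.Quotient.mk_trans]

theorem exists_extend_base (ξ : UnivCover x₀) : ∃ δ : Path x₀ ξ.pt,
    (base x₀).extend (y := ξ.pt) δ = ξ := by
  obtain ⟨y, c⟩ := ξ
  obtain ⟨δ, rfl⟩ := Path.Homotopic.Quotient.mk_surjective c
  exact ⟨δ, by simp [extend, base]⟩

/-- The subpath of `γ` from its source to `γ τ`. -/
def initial {a b : X} (γ : Path a b) (τ : I) : Path a (γ τ) :=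
  (γ.subpath 0 τ).cast γ.source.symm rfl

/-- The canonical lift of a path to the universal covering. -/
noncomputable def lift (ξ : UnivCover x₀) {y : X} (γ : Path ξ.pt y) (τ : I) : UnivCover x₀ :=
  ξ.extend (initial γ τ)

theorem lift_zero (ξ : UnivCover x₀) {y : X} (γ : Path ξ.pt y) : ξ.lift γ 0 = ξ := by
  conv_rhs => rw [← extend_refl ξ]
  refine extend_congr _ _ _ fun t => ?_
  simp [initial]

theorem lift_one (ξ : UnivCover x₀) {y : X} (γ : Path ξ.pt y) : ξ.lift γ 1 = ξ.extend γ := by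
  refine extend_congr _ _ _ fun t => ?_
  simp [initial]

theorem lift_extend_subpath (ξ : UnivCover x₀) {y : X} (γ : Path ξ.pt y) (ρ τ : I) :
    (ξ.lift γ ρ).extend (y := γ τ) (γ.subpath ρ τ) = ξ.lift γ τ := by
  refine (extend_extend ξ (initial γ ρ) (γ.subpath ρ τ)).trans ?_
  refine extend_eq_of_homotopic _ ?_
  have h : ((γ.subpath 0 ρ).trans (γ.subpath ρ τ)).Homotopic (γ.subpath 0 τ) :=
    ⟨Path.Homotopy.subpathTransSubpath γ 0 ρ τ⟩
  exact h.pathCast γ.source.symm rfl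

end Basic

section Metric

variable {X : Type*} [MetricSpace X] {x₀ : X}

/-- The classes that arise from `ξ` by moving the end point inside a ball. -/
def nbhd (ξ : UnivCover x₀) (r : ℝ) : Set (UnivCover x₀) :=
  {η | ∃ (y : X) (δ : Path ξ.pt y), Set.range δ ⊆ Metric.ball ξ.pt r ∧ ξ.extend δ = η}

theorem nbhd_mono (ξ : UnivCover x₀) {r r' : ℝ} (h : r ≤ r') : ξ.nbhd r ⊆ ξ.nbhd r' :=
  fun _ ⟨y, δ, hδ, e⟩ => ⟨y, δ, hδ.trans (Metric.ball_subset_ball h), e⟩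

theorem extend_mem_nbhd (ξ : UnivCover x₀) {y : X} (δ : Path ξ.pt y) {r : ℝ}
    (h : Set.range δ ⊆ Metric.ball ξ.pt r) : ξ.extend δ ∈ ξ.nbhd r := ⟨y, δ, h, rfl⟩

theorem mem_nbhd_self (ξ : UnivCover x₀) {r : ℝ} (hr : 0 < r) : ξ ∈ ξ.nbhd r :=
  ⟨_, Path.refl _, by simpa using hr, extend_refl ξ⟩

theorem pt_mem_ball {ξ η : UnivCover x₀} {r : ℝ} (h : η ∈ ξ.nbhd r) :
    η.pt ∈ Metric.ball ξ.pt r := by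
  obtain ⟨y, δ, hδ, rfl⟩ := h
  exact hδ ⟨1, δ.target⟩

theorem exists_nbhd_subset_nbhd {ξ η : UnivCover x₀} {r : ℝ} (h : η ∈ ξ.nbhd r) :
    ∃ r' > 0, η.nbhd r' ⊆ ξ.nbhd r := by
  obtain ⟨r', hr', hsub⟩ := Metric.isOpen_iff.1 Metric.isOpen_ball _ (pt_mem_ball h)
  refine ⟨r', hr', ?_⟩
  rintro ζ ⟨z, ε, hε, rfl⟩
  obtain ⟨y, δ, hδ, rfl⟩ := h
  change Path y z at ε
  rw [extend_extend]
  refine extend_mem_nbhd _ _ ?_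
  rw [Path.trans_range]
  exact Set.union_subset hδ (hε.trans hsub)

/-- The topology of the universal covering, generated by the sets `nbhd ξ r`. -/
instance : TopologicalSpace (UnivCover x₀) where
  IsOpen U := ∀ ξ ∈ U, ∃ r > 0, nbhd ξ r ⊆ U
  isOpen_univ _ _ := ⟨1, one_pos, Set.subset_univ _⟩
  isOpen_inter U V hU hV ξ hξ := by
    obtain ⟨r, hr, h⟩ := hU ξ hξ.1
    obtain ⟨s, hs, h'⟩ := hV ξ hξ.2
    exact ⟨min r s, lt_min hr hs, Set.subset_inter ((nbhd_mono _ (min_le_left _ _)).trans h)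
      ((nbhd_mono _ (min_le_right _ _)).trans h')⟩
  isOpen_sUnion 𝒰 h ξ hξ := by
    obtain ⟨U, hU, hξU⟩ := hξ
    obtain ⟨r, hr, hsub⟩ := h U hU ξ hξU
    exact ⟨r, hr, hsub.trans (Set.subset_sUnion_of_mem hU)⟩

theorem isOpen_nbhd (ξ : UnivCover x₀) (r : ℝ) : IsOpen (ξ.nbhd r) :=
  fun _ hη => exists_nbhd_subset_nbhd hη

theorem mem_nhds_iff {ξ : UnivCover x₀} {S : Set (UnivCover x₀)} :
    S ∈ 𝓝 ξ ↔ ∃ r > 0, ξ.nbhd r ⊆ S := by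
  constructor
  · intro h
    obtain ⟨U, hUS, hU, hξ⟩ := _root_.mem_nhds_iff.1 h
    obtain ⟨r, hr, hsub⟩ := hU ξ hξ
    exact ⟨r, hr, hsub.trans hUS⟩
  · rintro ⟨r, hr, hsub⟩
    exact Filter.mem_of_superset ((isOpen_nbhd ξ r).mem_nhds (mem_nbhd_self ξ hr)) hsub

theorem nbhd_mem_nhds (ξ : UnivCover x₀) {r : ℝ} (hr : 0 < r) : ξ.nbhd r ∈ 𝓝 ξ :=
  mem_nhds_iff.2 ⟨r, hr, subset_rfl⟩

theorem continuous_pt : Continuous (pt : UnivCover x₀ → X) := by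
  rw [continuous_iff_continuousAt]
  intro ξ U hU
  obtain ⟨r, hr, hsub⟩ := Metric.mem_nhds_iff.1 hU
  exact mem_nhds_iff.2 ⟨r, hr, fun η hη => hsub (pt_mem_ball hη)⟩

theorem continuous_lift (ξ : UnivCover x₀) {y : X} (γ : Path ξ.pt y) : Continuous (ξ.lift γ) := by
  rw [continuous_iff_continuousAt]
  intro ρ U hU
  obtain ⟨r, hr, hsub⟩ := mem_nhds_iff.1 hU
  obtain ⟨ε, hε, hball⟩ := Metric.isOpen_iff.1 (Metric.isOpen_ball.preimage γ.continuous)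
    ρ (Metric.mem_ball_self hr : γ ρ ∈ Metric.ball (γ ρ) r)
  refine Metric.mem_nhds_iff.2 ⟨ε, hε, fun τ hτ => hsub ?_⟩
  rw [← lift_extend_subpath ξ γ ρ τ]
  refine extend_mem_nbhd _ _ ?_
  change Set.range (γ.subpath ρ τ) ⊆ Metric.ball (γ ρ) r
  rw [Path.range_subpath]
  rintro _ ⟨t, ht, rfl⟩
  refine hball ?_
  rw [Metric.mem_ball, Subtype.dist_eq, Real.dist_eq] at hτ ⊢
  have ht' : (t : ℝ) ∈ Set.uIcc (ρ : ℝ) τ := by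
    rcases le_total ρ τ with h | h
    · rw [Set.uIcc_of_le h] at ht
      exact Set.Icc_subset_uIcc ht
    · rw [Set.uIcc_of_ge h] at ht
      exact Set.Icc_subset_uIcc' ht
  exact (Set.abs_sub_left_of_mem_uIcc ht').trans_lt (by rwa [abs_sub_comm] at hτ ⊢)

instance : PathConnectedSpace (UnivCover x₀) := by
  have h : ∀ ξ : UnivCover x₀, Joined (base x₀) ξ := by
    intro ξ
    obtain ⟨δ, hδ⟩ := exists_extend_base ξ
    exact ⟨⟨⟨lift (base x₀) δ, continuous_lift _ _⟩, lift_zero (base x₀) δ,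
      (lift_one (base x₀) δ).trans hδ⟩⟩
  exact ⟨⟨base x₀⟩, fun ξ η => (h ξ).symm.trans (h η)⟩

/-- All sufficiently small balls around every point are contractible. -/
def HasContractibleBalls (X : Type*) [MetricSpace X] : Prop :=
  ∀ y : X, ∃ r₀ > 0, ∀ r, 0 < r → r ≤ r₀ → ContractibleSpace (Metric.ball y r)

theorem _root_.Path.homotopic_of_range_subset {S : Set X} [SimplyConnectedSpace S] {a b : X}
    (δ δ' : Path a b) (h : Set.range δ ⊆ S) (h' : Set.range δ' ⊆ S) : δ.Homotopic δ' := by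
  have ha : a ∈ S := h ⟨0, δ.source⟩
  have hb : b ∈ S := h ⟨1, δ.target⟩
  let ε : Path (⟨a, ha⟩ : S) ⟨b, hb⟩ :=
    ⟨⟨fun t => ⟨δ t, h ⟨t, rfl⟩⟩, δ.continuous.subtype_mk _⟩, Subtype.ext δ.source,
      Subtype.ext δ.target⟩
  let ε' : Path (⟨a, ha⟩ : S) ⟨b, hb⟩ :=
    ⟨⟨fun t => ⟨δ' t, h' ⟨t, rfl⟩⟩, δ'.continuous.subtype_mk _⟩, Subtype.ext δ'.source,
      Subtype.ext δ'.target⟩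
  exact (SimplyConnectedSpace.paths_homotopic ε ε').map ⟨Subtype.val, continuous_subtype_val⟩

theorem _root_.exists_path_range_subset {S : Set X} [PathConnectedSpace S] {a b : X}
    (ha : a ∈ S) (hb : b ∈ S) : ∃ δ : Path a b, Set.range δ ⊆ S := by
  let ε := PathConnectedSpace.somePath (⟨a, ha⟩ : S) ⟨b, hb⟩
  refine ⟨ε.map continuous_subtype_val, ?_⟩
  rintro _ ⟨t, rfl⟩
  exact (ε t).2

variable (hX : HasContractibleBalls X)
include hX

theorem exists_injOn_pt_nbhd (y : X) : ∃ r₀ > 0, ∀ r ≤ r₀, ∀ ξ : UnivCover x₀, ξ.pt = y →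
    Set.InjOn pt (ξ.nbhd r) := by
  obtain ⟨r₀, h₀, hr⟩ := hX y
  refine ⟨r₀, h₀, ?_⟩
  rintro r hrr ξ rfl _ ⟨z, δ, hδ, rfl⟩ _ ⟨z', δ', hδ', rfl⟩ h
  have := hr r₀ h₀ le_rfl
  obtain rfl : z = z' := h
  exact extend_eq_of_homotopic _ (Path.homotopic_of_range_subset (S := Metric.ball ξ.pt r₀) _ _
    (hδ.trans (Metric.ball_subset_ball hrr)) (hδ'.trans (Metric.ball_subset_ball hrr)))

theorem isLocallyInjective_pt : IsLocallyInjective (pt : UnivCover x₀ → X) := by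
  intro ξ
  obtain ⟨r, hr, h⟩ := exists_injOn_pt_nbhd (x₀ := x₀) hX ξ.pt
  exact ⟨ξ.nbhd r, isOpen_nbhd _ _, mem_nbhd_self _ hr, h r le_rfl ξ rfl⟩

theorem t2Space : T2Space (UnivCover x₀) := by
  refine ⟨fun ξ η hne => ?_⟩
  by_cases hpt : ξ.pt = η.pt
  -- over one point, a common element of the neighbourhoods yields homotopic connecting paths in a
  -- contractible ball, so the classes are equal
  · obtain ⟨r, hr, h⟩ := hX ξ.pt
    refine ⟨ξ.nbhd r, η.nbhd r, isOpen_nbhd _ _, isOpen_nbhd _ _, mem_nbhd_self _ hr,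
      mem_nbhd_self _ hr, ?_⟩
    rw [Set.disjoint_left]
    rintro _ ⟨y, δ, hδ, rfl⟩ ⟨y', ε, hε, e⟩
    obtain rfl : y' = y := congrArg pt e
    have := h r hr le_rfl
    apply hne
    obtain ⟨z, c⟩ := ξ
    obtain ⟨z', c'⟩ := η
    obtain rfl : z = z' := hpt
    dsimp only at δ ε hδ hε h this
    have hhom : Path.Homotopic.Quotient.mk δ = Path.Homotopic.Quotient.mk ε :=
      Path.Homotopic.Quotient.eq.2 (Path.homotopic_of_range_subset (S := Metric.ball z r) δ ε hδ hε)
    have h1 := e.symm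
    simp only [extend, mk.injEq, heq_eq_eq, true_and] at h1
    rw [hhom] at h1
    have h2 := congrArg (fun q => Path.Homotopic.Quotient.trans q
      (Path.Homotopic.Quotient.symm (Path.Homotopic.Quotient.mk ε))) h1
    simp only [Path.Homotopic.Quotient.trans_assoc, Path.Homotopic.Quotient.trans_symm,
      Path.Homotopic.Quotient.trans_refl] at h2
    rw [h2]
  · obtain ⟨U, V, hU, hV, h1, h2, h3⟩ := t2_separation hpt
    exact ⟨_, _, hU.preimage continuous_pt, hV.preimage continuous_pt, h1, h2, h3.preimage _⟩

theorem exists_mem_nbhd_pt_eq (y : X) : ∃ r₀ > 0, ∀ r, 0 < r → r ≤ r₀ →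
    ∀ ξ : UnivCover x₀, ξ.pt = y → ∀ v ∈ Metric.ball y r, ∃ η ∈ ξ.nbhd r, η.pt = v := by
  obtain ⟨r₀, h₀, hr⟩ := hX y
  refine ⟨r₀, h₀, ?_⟩
  rintro r h hrr ξ rfl v hv
  have := hr r h hrr
  obtain ⟨δ, hδ⟩ := exists_path_range_subset (Metric.mem_ball_self h) hv
  exact ⟨ξ.extend δ, extend_mem_nbhd ξ δ hδ, rfl⟩

end Metric

end UnivCover

/-! ### Limits of paths in complete spaces and in coverings -/

section Paths

open scoped unitInterval
open Set Filter

/-- A path that is Lipschitz near every time before `T` is Lipschitz on all times before `T`. -/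
theorem dist_le_of_locally_lipschitz {M : Type*} [MetricSpace M] {u : I → M} {T : I} {K : ℝ}
    (hu : ∀ t < T, ∀ᶠ s in 𝓝 t, dist (u t) (u s) ≤ K * dist t s) {a b : I} (hab : a ≤ b)
    (hb : b < T) : dist (u a) (u b) ≤ K * dist a b := by
  have hdist : ∀ {s t : I}, s ≤ t → dist s t = t - s := fun {s t} h => by
    rw [Subtype.dist_eq, dist_comm, Real.dist_eq,
      abs_of_nonneg (sub_nonneg.2 (Subtype.coe_le_coe.2 h))]
  have hcont : ContinuousOn u (Icc a b) := by
    intro t ht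
    refine ContinuousAt.continuousWithinAt ?_
    have h1 : Continuous fun s : I => K * dist t s := by fun_prop
    have h2 : Tendsto (fun s : I => K * dist t s) (𝓝 t) (𝓝 0) := by simpa using h1.tendsto t
    rw [ContinuousAt, tendsto_iff_dist_tendsto_zero]
    simp_rw [dist_comm (u _) (u t)]
    exact squeeze_zero' (Eventually.of_forall fun _ => dist_nonneg) (hu t (ht.2.trans_lt hb)) h2
  have key : Icc a b ⊆ {t : I | dist (u a) (u t) ≤ K * dist a t} := by
    refine IsClosed.Icc_subset_of_forall_exists_gt ?_ (by simp) ?_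
    · have h1 : ContinuousOn (fun t => dist (u a) (u t)) (Icc a b) := by fun_prop
      have h2 : ContinuousOn (fun t => K * dist a t) (Icc a b) := by fun_prop
      rw [inter_comm]
      exact isClosed_Icc.isClosed_le h1 h2
    · rintro x ⟨hx, hxab⟩ y hy
      have hxy : x < min y b := lt_min hy hxab.2
      have h1 : ∀ᶠ s in 𝓝[>] x, dist (u x) (u s) ≤ K * dist x s :=
        (hu x (hxab.2.trans hb)).filter_mono nhdsWithin_le_nhds
      have := nhdsGT_neBot_of_exists_gt ⟨_, hxy⟩
      obtain ⟨s, hs, hs'⟩ := (h1.and (Ioc_mem_nhdsGT hxy)).exists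
      refine ⟨s, ?_, hs'.1, hs'.2.trans (min_le_left _ _)⟩
      have h2 := dist_triangle (u a) (u x) (u s)
      simp only [mem_ofPred] at hx ⊢
      rw [hdist hxab.1] at hx
      rw [hdist hs'.1.le] at hs
      rw [hdist (hxab.1.trans hs'.1.le)]
      linarith
  exact key ⟨hab, le_rfl⟩

theorem exists_tendsto_of_locally_lipschitz {M : Type*} [MetricSpace M] [CompleteSpace M]
    {u : I → M} {T : I} (hT : 0 < T) {K : ℝ}
    (hu : ∀ t < T, ∀ᶠ s in 𝓝 t, dist (u t) (u s) ≤ K * dist t s) :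
    ∃ m, Tendsto u (𝓝[<] T) (𝓝 m) := by
  have hne : (𝓝[<] T).NeBot := nhdsLT_neBot_of_exists_lt ⟨0, hT⟩
  refine cauchy_map_iff_exists_tendsto.1 (Metric.cauchy_iff.2 ⟨inferInstance, fun ε hε => ?_⟩)
  have hL : ∀ a < T, ∀ b < T, dist (u a) (u b) ≤ |K| * dist a b := by
    intro a ha b hb
    have hK : ∀ s t : I, K * dist s t ≤ |K| * dist s t := fun s t =>
      mul_le_mul_of_nonneg_right (le_abs_self K) dist_nonneg
    rcases le_total a b with h | h
    · exact (dist_le_of_locally_lipschitz hu h hb).trans (hK _ _)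
    · rw [dist_comm, dist_comm a]
      exact (dist_le_of_locally_lipschitz hu h ha).trans (hK _ _)
  set η := ε / (2 * (|K| + 1)) with hη
  have hη0 : 0 < η := by positivity
  refine ⟨u '' (Metric.ball T η ∩ Iio T), image_mem_map
    (inter_mem (mem_nhdsWithin_of_mem_nhds (Metric.ball_mem_nhds T hη0)) self_mem_nhdsWithin), ?_⟩
  rintro _ ⟨a, ha, rfl⟩ _ ⟨b, hb, rfl⟩
  have h1 : dist a b < 2 * η := by
    have := dist_triangle_right a b T
    have := Metric.mem_ball.1 ha.1
    have := Metric.mem_ball.1 hb.1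
    linarith
  calc dist (u a) (u b) ≤ |K| * dist a b := hL a ha.2 b hb.2
    _ ≤ |K| * (2 * η) := by gcongr
    _ < (|K| + 1) * (2 * η) := by gcongr; linarith
    _ = ε := by rw [hη]; field_simp

/-- If the image of a path in the base of a covering has a limit, so has the path. -/
theorem IsCoveringMap.exists_tendsto {E X : Type*} [TopologicalSpace E] [TopologicalSpace X]
    {p : E → X} (hp : IsCoveringMap p) {T : I} (hT : 0 < T) {β : I → E}
    (hβ : ContinuousOn β (Iio T)) {m : X} (hm : Tendsto (fun t => p (β t)) (𝓝[<] T) (𝓝 m)) :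
    ∃ n, Tendsto β (𝓝[<] T) (𝓝 n) := by
  have hne : (𝓝[<] T).NeBot := nhdsLT_neBot_of_exists_lt ⟨0, hT⟩
  have hev := hp m
  have : Nonempty (p ⁻¹' {m}) := by
    obtain ⟨-, U, hmU, hU, -, H, -⟩ := hp m
    obtain ⟨t, ht⟩ := (hm.eventually (hU.mem_nhds hmU)).exists
    exact ⟨(H ⟨β t, ht⟩).2⟩
  have hdisc : DiscreteTopology (p ⁻¹' {m}) := hev.1
  set e := hev.toTrivialization
  have hme : m ∈ e.baseSet := hev.mem_toTrivialization_baseSet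
  have hbase : ∀ᶠ t in 𝓝[<] T, p (β t) ∈ e.baseSet := hm.eventually (e.open_baseSet.mem_nhds hme)
  obtain ⟨t₀, ht₀, hsub₀⟩ := (mem_nhdsLT_iff_exists_Ioo_subset' hT).1 hbase
  obtain ⟨t₁, ht₀₁, ht₁⟩ := exists_between (mem_Iio.1 ht₀)
  have hsub : ∀ t ∈ Ico t₁ T, p (β t) ∈ e.baseSet := fun t ht =>
    hsub₀ ⟨ht₀₁.trans_le ht.1, ht.2⟩
  have hsrc : ∀ t ∈ Ico t₁ T, β t ∈ e.source := fun t ht => e.mem_source.2 (hsub t ht)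
  -- the sheet in which the path runs does not change
  have hconst : ∀ t ∈ Ico t₁ T, (e (β t)).2 = (e (β t₁)).2 := by
    intro t ht
    have hc : ContinuousOn (fun t => (e (β t)).2) (Ico t₁ T) :=
      continuous_snd.comp_continuousOn
        (e.continuousOn_toFun.comp (hβ.mono fun t ht => ht.2) hsrc)
    exact isPreconnected_Ico.constant hc ht ⟨le_rfl, ht₁⟩
  refine ⟨e.toOpenPartialHomeomorph.symm (m, (e (β t₁)).2), ?_⟩
  have hcont := e.toOpenPartialHomeomorph.continuousAt_symm (x := (m, (e (β t₁)).2))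
    (by rw [e.target_eq]; exact ⟨hme, trivial⟩)
  have hlim : Tendsto (fun t => (p (β t), (e (β t₁)).2)) (𝓝[<] T) (𝓝 (m, (e (β t₁)).2)) :=
    hm.prodMk_nhds tendsto_const_nhds
  refine (hcont.tendsto.comp hlim).congr' ?_
  filter_upwards [Ico_mem_nhdsLT ht₁] with t ht
  have h1 : (p (β t), (e (β t₁)).2) = e (β t) :=
    Prod.ext (e.coe_fst (hsrc t ht)).symm (hconst t ht).symm
  simp only [Function.comp]
  rw [h1]
  exact e.left_inv (hsrc t ht)

end Paths

/-! ### The developing map -/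

/-- The developing map as a map on the universal covering. -/
def dev {X : Type*} [TopologicalSpace X] {x₀ : X}
    (D : (y : X) → Path.Homotopic.Quotient x₀ y → HypSpace) (ξ : UnivCover x₀) : HypSpace :=
  D ξ.pt ξ.cls

section Dev

open UnivCover Set Filter
open scoped unitInterval

variable {N : Type*} [MetricSpace N] {x₀ : N}
  {D : (y : N) → Path.Homotopic.Quotient x₀ y → HypSpace}

theorem IsHypThreeManifold.hasContractibleBalls (hN : IsHypThreeManifold N) :
    HasContractibleBalls N := fun y => by
  obtain ⟨r₀, h₀, h⟩ := hN.exists_isHypBall y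
  exact ⟨r₀, h₀, fun r hr hrr => (h r hr hrr).contractibleSpace hr⟩

theorem IsHypOrientable.isHypThreeManifold (hN : IsHypOrientable N) : IsHypThreeManifold N := by
  obtain ⟨𝒜, h1, h2, -⟩ := hN
  intro x
  obtain ⟨c, hc, hx⟩ := h2 x
  exact ⟨c.1, c.2, hx, h1 c hc⟩

theorem IsHypThreeManifold.isSeparatedMap_dev (hN : IsHypThreeManifold N) :
    IsSeparatedMap (dev D) :=
  have := UnivCover.t2Space (x₀ := x₀) hN.hasContractibleBalls
  T2Space.isSeparatedMap _

namespace IsDevelopingMap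

variable (hD : IsDevelopingMap x₀ D)
include hD

theorem exists_dist_dev (y : N) : ∃ r > 0, ∀ ξ : UnivCover x₀, ξ.pt = y →
    ∀ η ∈ ξ.nbhd r, ∀ ζ ∈ ξ.nbhd r, dist (dev D η) (dev D ζ) = dist η.pt ζ.pt := by
  obtain ⟨r, hr, h⟩ := hD y
  refine ⟨r, hr, ?_⟩
  rintro ξ rfl _ ⟨y₁, δ₁, h₁, rfl⟩ _ ⟨y₂, δ₂, h₂, rfl⟩
  exact h ξ.cls y₁ y₂ δ₁ δ₂ h₁ h₂

theorem eventually_dist_dev (ξ : UnivCover x₀) :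
    ∃ U ∈ 𝓝 ξ, ∀ η ∈ U, ∀ ζ ∈ U, dist (dev D η) (dev D ζ) = dist η.pt ζ.pt := by
  obtain ⟨r, hr, h⟩ := hD.exists_dist_dev ξ.pt
  exact ⟨_, nbhd_mem_nhds ξ hr, h ξ rfl⟩

theorem continuous_dev : Continuous (dev D) := by
  rw [continuous_iff_continuousAt]
  intro ξ
  obtain ⟨U, hU, h⟩ := hD.eventually_dist_dev ξ
  rw [ContinuousAt, tendsto_iff_dist_tendsto_zero]
  have h1 := (tendsto_iff_dist_tendsto_zero.1 (continuous_pt.tendsto ξ))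
  refine h1.congr' ?_
  filter_upwards [hU] with η hη
  exact (h η hη ξ (mem_of_mem_nhds hU)).symm

variable (hN : IsHypThreeManifold N)
include hN

/-- The developing map sends small basic neighbourhoods in the universal covering bijectively onto
balls of the same radius. -/
theorem exists_image_dev (ξ : UnivCover x₀) : ∃ r₀ > 0, ∀ r, 0 < r → r ≤ r₀ →
    InjOn (dev D) (ξ.nbhd r) ∧ dev D '' ξ.nbhd r = Metric.ball (dev D ξ) r := by
  obtain ⟨r₁, h₁, hdist⟩ := hD.exists_dist_dev ξ.pt
  obtain ⟨r₂, h₂, hball⟩ := hN.exists_isHypBall ξ.pt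
  obtain ⟨r₃, h₃, hinj⟩ := exists_injOn_pt_nbhd (x₀ := x₀) hN.hasContractibleBalls ξ.pt
  obtain ⟨r₄, h₄, hsurj⟩ := exists_mem_nbhd_pt_eq (x₀ := x₀) hN.hasContractibleBalls ξ.pt
  refine ⟨min (min r₁ r₂) (min r₃ r₄), lt_min (lt_min h₁ h₂) (lt_min h₃ h₄), fun r hr hrr => ?_⟩
  have hr₁ : r ≤ r₁ := hrr.trans ((min_le_left _ _).trans (min_le_left _ _))
  have hr₂ : r ≤ r₂ := hrr.trans ((min_le_left _ _).trans (min_le_right _ _))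
  have hr₃ : r ≤ r₃ := hrr.trans ((min_le_right _ _).trans (min_le_left _ _))
  have hr₄ : r ≤ r₄ := hrr.trans ((min_le_right _ _).trans (min_le_right _ _))
  have hd : ∀ η ∈ ξ.nbhd r, ∀ ζ ∈ ξ.nbhd r, dist (dev D η) (dev D ζ) = dist η.pt ζ.pt :=
    fun η hη ζ hζ => hdist ξ rfl η (nbhd_mono ξ hr₁ hη) ζ (nbhd_mono ξ hr₁ hζ)
  have hpt := hinj r hr₃ ξ rfl
  refine ⟨fun η hη ζ hζ h => hpt hη hζ ?_, ?_⟩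
  · rw [← dist_eq_zero, ← hd η hη ζ hζ, h, dist_self]
  have : Nonempty (UnivCover x₀) := ⟨ξ⟩
  choose! k hk hkpt using hsurj r hr hr₄ ξ rfl
  have hself := mem_nbhd_self ξ hr
  have hkξ : k ξ.pt = ξ :=
    hpt (hk _ (Metric.mem_ball_self hr)) hself (hkpt _ (Metric.mem_ball_self hr))
  have h1 : dev D '' ξ.nbhd r = (fun v => dev D (k v)) '' Metric.ball ξ.pt r := by
    ext b
    constructor
    · rintro ⟨η, hη, rfl⟩
      refine ⟨η.pt, pt_mem_ball hη, ?_⟩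
      change dev D (k η.pt) = _
      rw [hpt (hk _ (pt_mem_ball hη)) hη (hkpt _ (pt_mem_ball hη))]
    · rintro ⟨v, hv, rfl⟩
      exact ⟨k v, hk v hv, rfl⟩
  rw [h1, (hball r hr hr₂).image_eq_ball hr, hkξ]
  intro u hu v hv
  rw [hd _ (hk u hu) _ (hk v hv), hkpt u hu, hkpt v hv]

theorem isLocalHomeomorph_dev : IsLocalHomeomorph (dev D) := by
  rw [isLocalHomeomorph_iff_isOpenEmbedding_restrict]
  have hopen : IsOpenMap (dev D) := by
    rw [isOpenMap_iff_nhds_le]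
    intro ξ S hS
    obtain ⟨r, hr, hsub⟩ := UnivCover.mem_nhds_iff.1 (Filter.mem_map.1 hS)
    obtain ⟨r₀, h₀, h⟩ := hD.exists_image_dev hN ξ
    have h1 := (h (min r r₀) (lt_min hr h₀) (min_le_right _ _)).2
    refine Filter.mem_of_superset (Metric.ball_mem_nhds (dev D ξ) (lt_min hr h₀)) ?_
    rw [← h1]
    rintro _ ⟨η, hη, rfl⟩
    exact hsub (nbhd_mono ξ (min_le_left _ _) hη)
  intro ξ
  obtain ⟨r₀, h₀, h⟩ := hD.exists_image_dev hN ξ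
  refine ⟨ξ.nbhd r₀, nbhd_mem_nhds ξ h₀, ?_⟩
  exact Topology.IsOpenEmbedding.of_continuous_injective_isOpenMap
    (hD.continuous_dev.comp continuous_subtype_val)
    (injOn_iff_injective.1 (h r₀ h₀ le_rfl).1)
    (hopen.comp (isOpen_nbhd ξ r₀).isOpenMap_subtype_val)

/-- The times up to which a path can be lifted through the developing map form an open set. -/
theorem isOpen_lift_times (ξ : UnivCover x₀) (α : C(I, HypSpace)) :
    IsOpen {T : I | ∃ Γ : C(I, UnivCover x₀), Γ 0 = ξ ∧ ∀ t ≤ T, dev D (Γ t) = α t} := by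
  rw [isOpen_iff_mem_nhds]
  rintro T ⟨Γ, hΓ0, hΓ⟩
  obtain ⟨e, he, hdev⟩ := hD.isLocalHomeomorph_dev hN (Γ T)
  have hT : α T ∈ e.target := by
    rw [← hΓ T le_rfl, hdev]
    exact e.map_source he
  obtain ⟨ε, hε, hball⟩ := Metric.isOpen_iff.1 (e.open_target.preimage α.continuous) T hT
  refine Metric.mem_nhds_iff.2 ⟨ε, hε, fun T' hT' => ?_⟩
  rcases le_total T' T with h | h
  · exact ⟨Γ, hΓ0, fun t ht => hΓ t (ht.trans h)⟩
  have hmem : ∀ t, T ≤ t → t ≤ T' → α t ∈ e.target := by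
    intro t h1 h2
    refine hball ?_
    have h3 : (T : ℝ) ≤ t := h1
    have h4 : (t : ℝ) ≤ T' := h2
    rw [Metric.mem_ball, Subtype.dist_eq, Real.dist_eq] at hT' ⊢
    rw [abs_of_nonneg (by linarith)] at hT' ⊢
    linarith
  have hcont : Continuous fun t : I => e.symm (α (max T (min t T'))) := by
    refine e.continuousOn_symm.comp_continuous (by fun_prop) fun t => ?_
    exact hmem _ (le_max_left _ _) (max_le h (min_le_right _ _))
  refine ⟨⟨fun t => if t ≤ T then Γ t else e.symm (α (max T (min t T'))),
    Γ.continuous.if_le hcont continuous_id continuous_const ?_⟩, ?_, ?_⟩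
  · intro t ht
    obtain rfl : t = T := ht
    rw [min_eq_left h, max_self, ← hΓ t le_rfl, hdev, e.left_inv he]
  · simpa using hΓ0
  · intro t ht
    simp only [ContinuousMap.coe_mk]
    split_ifs with htT
    · exact hΓ t htT
    · have htT' := (not_le.1 htT).le
      rw [min_eq_left ht, max_eq_right htT', hdev]
      exact e.right_inv (hmem t htT' ht)

/-- The times up to which a Lipschitz path can be lifted through the developing map form a closed
set: the lift projects to a Lipschitz path in the complete space `M`, which has a limit. -/
theorem isClosed_lift_times {M : Type*} [MetricSpace M] [CompleteSpace M] {p : N → M}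
    (hp : IsCoveringMap p)
    (hiso : ∀ x : N, ∃ r > 0, ∀ y ∈ Metric.ball x r, ∀ z ∈ Metric.ball x r,
      dist (p y) (p z) = dist y z)
    (ξ : UnivCover x₀) (α : C(I, HypSpace)) (h0 : dev D ξ = α 0) {K : ℝ}
    (hα : ∀ s t, dist (α s) (α t) ≤ K * dist s t) :
    IsClosed {T : I | ∃ Γ : C(I, UnivCover x₀), Γ 0 = ξ ∧ ∀ t ≤ T, dev D (Γ t) = α t} := by
  set S := {T : I | ∃ Γ : C(I, UnivCover x₀), Γ 0 = ξ ∧ ∀ t ≤ T, dev D (Γ t) = α t} with hS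
  have hdown : ∀ s t : I, s ≤ t → t ∈ S → s ∈ S := fun s t hst ⟨Γ, h1, h2⟩ =>
    ⟨Γ, h1, fun u hu => h2 u (hu.trans hst)⟩
  have hzero : (0 : I) ∈ S := ⟨ContinuousMap.const I ξ, rfl, fun t ht => by
    obtain rfl : t = 0 := le_antisymm ht t.2.1
    exact h0⟩
  refine isClosed_of_closure_subset fun T hT => ?_
  by_contra hTS
  have hT0 : 0 < T := lt_of_le_of_ne T.2.1 fun h => hTS (h ▸ hzero)
  have hlt : ∀ t < T, t ∈ S := by
    intro t ht
    obtain ⟨s, hs, hsS⟩ := mem_closure_iff.1 hT _ isOpen_Ioi ht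
    exact hdown t s (le_of_lt hs) hsS
  have : Nonempty (C(I, UnivCover x₀)) := ⟨ContinuousMap.const I ξ⟩
  choose! Γ hΓ0 hΓ using hlt
  have hsep := hN.isSeparatedMap_dev (D := D)
  have hinj := (hD.isLocalHomeomorph_dev hN).isLocallyInjective
  -- the lifts agree where they are defined, hence glue to a lift on all times before `T`
  have hagree : ∀ t s : I, t ≤ s → s < T → Γ t t = Γ s t := by
    intro t s hts hsT
    refine hsep.eqOn_of_comp_eqOn hinj (isPreconnected_Icc (a := 0) (b := t))
      (Γ t).continuous.continuousOn (Γ s).continuous.continuousOn ?_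
      (a := 0) ⟨le_rfl, t.2.1⟩ ?_ ⟨t.2.1, le_rfl⟩
    · intro u hu
      simp only [Function.comp]
      rw [hΓ t (hts.trans_lt hsT) u hu.2, hΓ s hsT u (hu.2.trans hts)]
    · rw [hΓ0 t (hts.trans_lt hsT), hΓ0 s hsT]
  set g : I → UnivCover x₀ := fun t => Γ t t with hg
  have hgdev : ∀ t < T, dev D (g t) = α t := fun t ht => hΓ t ht t le_rfl
  have hgcont : ∀ t < T, ContinuousAt g t := by
    intro t ht
    obtain ⟨s, hts, hsT⟩ := exists_between ht
    refine (Γ s).continuous.continuousAt.congr ?_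
    filter_upwards [Iio_mem_nhds hts] with u hu
    exact (hagree u s (le_of_lt hu) hsT).symm
  have hβ : ∀ t < T, ContinuousAt (fun t => (g t).pt) t := fun t ht =>
    continuous_pt.continuousAt.comp (hgcont t ht)
  have hu : ∀ t < T, ∀ᶠ s in 𝓝 t, dist (p (g t).pt) (p (g s).pt) ≤ K * dist t s := by
    intro t ht
    obtain ⟨U, hU, hUd⟩ := hD.eventually_dist_dev (g t)
    obtain ⟨r, hr, hrd⟩ := hiso (g t).pt
    filter_upwards [hgcont t ht hU, hβ t ht (Metric.ball_mem_nhds _ hr), Iio_mem_nhds ht]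
      with s hs1 hs2 hs3
    rw [hrd _ (Metric.mem_ball_self hr) _ hs2, ← hUd _ (mem_of_mem_nhds hU) _ hs1,
      hgdev t ht, hgdev s hs3]
    exact hα t s
  obtain ⟨m, hm⟩ := exists_tendsto_of_locally_lipschitz hT0 hu
  obtain ⟨n, hn⟩ := hp.exists_tendsto hT0
    (fun t ht => (hβ t ht).continuousWithinAt) hm
  classical
  set β : I → N := fun t => if t < T then (g t).pt else n with hβdef
  have hβlt : ∀ t < T, β t = (g t).pt := fun t ht => if_pos ht
  have hβcont : Continuous β := by
    rw [continuous_iff_continuousAt]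
    intro t
    rcases lt_trichotomy t T with h | rfl | h
    · refine (hβ t h).congr ?_
      filter_upwards [Iio_mem_nhds h] with s hs
      exact (hβlt s hs).symm
    · have hβT : β t = n := if_neg (lt_irrefl t)
      rw [continuousAt_iff_continuous_left'_right', ContinuousWithinAt, ContinuousWithinAt, hβT]
      constructor
      · refine hn.congr' ?_
        filter_upwards [self_mem_nhdsWithin] with s hs
        exact (hβlt s hs).symm
      · refine tendsto_const_nhds.congr' ?_
        filter_upwards [self_mem_nhdsWithin] with s hs
        exact (if_neg (not_lt.2 (le_of_lt hs))).symm
    · refine (continuousAt_const (y := n)).congr ?_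
      filter_upwards [Ioi_mem_nhds h] with s hs
      exact (if_neg (not_lt.2 (le_of_lt hs))).symm
  have hg0 : g 0 = ξ := hΓ0 0 hT0
  let γ : Path ξ.pt (β 1) := ⟨⟨β, hβcont⟩, by
    change β 0 = _
    rw [hβlt 0 hT0, hg0], rfl⟩
  -- the canonical lift of the completed path extends the lift `g`
  have hlift : ∀ t < T, ξ.lift γ t = g t := by
    have := UnivCover.t2Space (x₀ := x₀) hN.hasContractibleBalls
    intro t ht
    refine (T2Space.isSeparatedMap (pt : UnivCover x₀ → N)).eqOn_of_comp_eqOn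
      (isLocallyInjective_pt hN.hasContractibleBalls) (isPreconnected_Icc (a := 0) (b := t))
      (continuous_lift ξ γ).continuousOn
      (fun s hs => (hgcont s (hs.2.trans_lt ht)).continuousWithinAt) ?_
      (a := 0) ⟨le_rfl, t.2.1⟩ ?_ ⟨t.2.1, le_rfl⟩
    · intro s hs
      exact hβlt s (hs.2.trans_lt ht)
    · rw [lift_zero, hg0]
  have hcl : IsClosed {t : I | dev D (ξ.lift γ t) = α t} :=
    isClosed_eq (hD.continuous_dev.comp (continuous_lift ξ γ)) α.continuous
  have hTcl : T ∈ closure (Iio T) := by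
    rw [closure_Iio' (α := I) ⟨0, hT0⟩]
    exact self_mem_Iic
  have hsub : closure (Iio T) ⊆ {t : I | dev D (ξ.lift γ t) = α t} :=
    hcl.closure_subset_iff.2 fun t ht => by
      change dev D (ξ.lift γ t) = α t
      rw [hlift t ht, hgdev t ht]
  refine hTS ⟨⟨ξ.lift γ, continuous_lift ξ γ⟩, lift_zero ξ γ, fun t ht => ?_⟩
  rcases ht.lt_or_eq with h | rfl
  · exact hsub (subset_closure h)
  · exact hsub hTcl

/-- Lipschitz paths lift through the developing map of a manifold that covers a complete space by
local isometries. -/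
theorem exists_lift_dev {M : Type*} [MetricSpace M] [CompleteSpace M] {p : N → M}
    (hp : IsCoveringMap p)
    (hiso : ∀ x : N, ∃ r > 0, ∀ y ∈ Metric.ball x r, ∀ z ∈ Metric.ball x r,
      dist (p y) (p z) = dist y z)
    (ξ : UnivCover x₀) (α : C(I, HypSpace)) (h0 : dev D ξ = α 0) {K : ℝ}
    (hα : ∀ s t, dist (α s) (α t) ≤ K * dist s t) :
    ∃ Γ : C(I, UnivCover x₀), Γ 0 = ξ ∧ ∀ t, dev D (Γ t) = α t := by
  have huniv := IsClopen.eq_univ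
    ⟨hD.isClosed_lift_times hN hp hiso ξ α h0 hα, hD.isOpen_lift_times hN ξ α⟩
    ⟨0, ContinuousMap.const I ξ, rfl, fun t ht => by
      obtain rfl : t = 0 := le_antisymm ht t.2.1
      exact h0⟩
  obtain ⟨Γ, h1, h2⟩ := huniv.ge (mem_univ (1 : I))
  exact ⟨Γ, h1, fun t => h2 t t.2.2⟩

end IsDevelopingMap

end Dev

/-! ### The covering of a complete hyperbolic manifold by hyperbolic space -/

namespace HypSpace

open scoped unitInterval

theorem dist_le_div {p q : HypSpace} {m : ℝ} (hm : 0 < m) (hp : m ≤ p.t) (hq : m ≤ q.t) :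
    dist p q ≤ √(‖p.z - q.z‖ ^ 2 + (p.t - q.t) ^ 2) / m := by
  have h1 : dist p q / 2 ≤ Real.sinh (dist p q / 2) :=
    Real.self_le_sinh_iff.2 (by positivity)
  rw [sinh_half_dist, dist_toEucl] at h1
  have h2 : m ≤ √(p.t * q.t) := Real.le_sqrt_of_sq_le (by nlinarith)
  calc dist p q = 2 * (dist p q / 2) := by ring
    _ ≤ 2 * (√(‖p.z - q.z‖ ^ 2 + (p.t - q.t) ^ 2) / (2 * √(p.t * q.t))) := by gcongr
    _ = √(‖p.z - q.z‖ ^ 2 + (p.t - q.t) ^ 2) / √(p.t * q.t) := by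
      have : 0 < √(p.t * q.t) := hm.trans_le h2
      field_simp
    _ ≤ _ := by gcongr

theorem segment_t_pos (o a : HypSpace) (t : I) : 0 < (1 - (t : ℝ)) * o.t + t * a.t := by
  have h := convex_upperHalf (x := coords o) o.t_pos (y := coords a) a.t_pos
    (a := 1 - (t : ℝ)) (b := t) (sub_nonneg.2 t.2.2) t.2.1 (by ring)
  exact h

/-- The Euclidean segment from `o` to `a`, parametrized by the unit interval. -/
noncomputable def segment (o a : HypSpace) (t : I) : HypSpace :=
  ⟨(1 - (t : ℝ)) • o.z + (t : ℝ) • a.z, (1 - (t : ℝ)) * o.t + t * a.t, segment_t_pos o a t⟩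

@[simp] theorem segment_zero (o a : HypSpace) : segment o a 0 = o := by
  ext1 <;> simp [segment]

@[simp] theorem segment_one (o a : HypSpace) : segment o a 1 = a := by
  ext1 <;> simp [segment]

@[simp] theorem segment_self (o : HypSpace) (t : I) : segment o o t = o := by
  ext1
  · simp only [segment]
    rw [← add_smul]
    simp
  · simp only [segment]
    ring

theorem continuous_z : Continuous z := continuous_fst.comp continuous_coords

theorem continuous_t : Continuous t := continuous_snd.comp continuous_coords

theorem continuous_segment (o : HypSpace) :
    Continuous fun x : I × HypSpace => segment o x.2 x.1 := by
  have hz : Continuous fun x : I × HypSpace => x.2.z := continuous_z.comp continuous_snd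
  have ht : Continuous fun x : I × HypSpace => x.2.t := continuous_t.comp continuous_snd
  have h : Continuous fun x : I × HypSpace =>
      (((1 - (x.1 : ℝ)) • o.z + (x.1 : ℝ) • x.2.z, (1 - (x.1 : ℝ)) * o.t + x.1 * x.2.t) : ℂ × ℝ) := by
    fun_prop
  exact continuous_ofCoords.comp (h.subtype_mk fun x => segment_t_pos o x.2 x.1)

theorem exists_dist_segment_le (o a : HypSpace) :
    ∃ K : ℝ, ∀ s t : I, dist (segment o a s) (segment o a t) ≤ K * dist s t := by
  set m := min o.t a.t with hm
  have hm0 : 0 < m := lt_min o.t_pos a.t_pos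
  have hge : ∀ t : I, m ≤ (segment o a t).t := by
    intro t
    have h1 : m ≤ o.t := min_le_left _ _
    have h2 : m ≤ a.t := min_le_right _ _
    have h3 := mul_le_mul_of_nonneg_left h1 (sub_nonneg.2 t.2.2)
    have h4 := mul_le_mul_of_nonneg_left h2 t.2.1
    simp only [segment]
    linarith
  refine ⟨√(‖a.z - o.z‖ ^ 2 + (a.t - o.t) ^ 2) / m, fun s t => ?_⟩
  refine (dist_le_div hm0 (hge s) (hge t)).trans (le_of_eq ?_)
  have h1 : (segment o a s).z - (segment o a t).z = ((s : ℝ) - t) • (a.z - o.z) := by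
    simp only [segment]
    module
  have h2 : (segment o a s).t - (segment o a t).t = ((s : ℝ) - t) * (a.t - o.t) := by
    simp only [segment]
    ring
  rw [h1, h2, norm_smul, Real.norm_eq_abs, mul_pow, mul_pow, sq_abs, ← mul_add,
    Real.sqrt_mul (sq_nonneg _), Real.sqrt_sq_eq_abs, Subtype.dist_eq, Real.dist_eq]
  ring

end HypSpace

section Uniformization

open UnivCover Set Filter
open scoped unitInterval

variable {N : Type*} [MetricSpace N] {x₀ : N}
  {D : (y : N) → Path.Homotopic.Quotient x₀ y → HypSpace}

/-- The developing map of a complete hyperbolic manifold is bijective, with continuous inverse: the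
lifts of the Euclidean segments from a base point form a continuous section by the monodromy
argument, and this section is onto because the universal covering is connected. -/
theorem IsDevelopingMap.exists_section (hD : IsDevelopingMap x₀ D) (hN : IsHypThreeManifold N)
    {M : Type*} [MetricSpace M] [CompleteSpace M] {p : N → M} (hp : IsCoveringMap p)
    (hiso : ∀ x : N, ∃ r > 0, ∀ y ∈ Metric.ball x r, ∀ z ∈ Metric.ball x r,
      dist (p y) (p z) = dist y z) :
    ∃ s : HypSpace → UnivCover x₀, Continuous s ∧ (∀ a, dev D (s a) = a) ∧
      ∀ ξ, s (dev D ξ) = ξ := by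
  set o := dev D (base x₀) with ho
  have hex : ∀ a : HypSpace, ∃ Γ : C(I, UnivCover x₀), Γ 0 = base x₀ ∧
      ∀ t, dev D (Γ t) = HypSpace.segment o a t := by
    intro a
    obtain ⟨K, hK⟩ := HypSpace.exists_dist_segment_le o a
    exact hD.exists_lift_dev hN hp hiso (base x₀)
      ⟨HypSpace.segment o a, (HypSpace.continuous_segment o).comp (Continuous.prodMk_left a)⟩
      (by simp [ho]) hK
  choose Γ hΓ0 hΓ using hex
  have hsep := hN.isSeparatedMap_dev (D := D)
  have hloc := hD.isLocalHomeomorph_dev hN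
  have hcont : Continuous fun x : I × HypSpace => Γ x.2 x.1 := by
    refine hloc.continuous_lift hsep
      ⟨fun x => HypSpace.segment o x.2 x.1, HypSpace.continuous_segment o⟩
      (funext fun x => hΓ x.2 x.1) ?_ fun a => (Γ a).continuous
    simp only [hΓ0]
    exact continuous_const
  have hs : Continuous fun a => Γ a 1 := hcont.comp (Continuous.prodMk_right 1)
  have hdev : ∀ a, dev D (Γ a 1) = a := fun a => by rw [hΓ, HypSpace.segment_one]
  refine ⟨fun a => Γ a 1, hs, hdev, fun ξ => ?_⟩
  have hbase : Γ (dev D (base x₀)) 1 = base x₀ := by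
    refine Eq.trans ?_ (hΓ0 o)
    refine hsep.const_of_comp hloc.isLocallyInjective (Γ o).continuous (fun t t' => ?_) 1 0
    rw [hΓ, hΓ, HypSpace.segment_self, HypSpace.segment_self]
  exact congrFun (hsep.eq_of_comp_eq hloc.isLocallyInjective (hs.comp hD.continuous_dev)
    continuous_id (funext fun η => hdev (dev D η)) (base x₀) hbase) ξ

/-- A complete hyperbolic manifold is the quotient of hyperbolic space by its holonomy group. -/
theorem IsDevelopingMap.exists_uniformization (hD : IsDevelopingMap x₀ D)
    (hN : IsHypThreeManifold N) {h : FundamentalGroup N x₀ →* PSL(2, ℂ)}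
    (hequiv : ∀ (γ : FundamentalGroup N x₀) (y : N) (c : Path.Homotopic.Quotient x₀ y),
      D y ((FundamentalGroup.toPath γ).symm.trans c) = h γ • D y c)
    {M : Type*} [MetricSpace M] [CompleteSpace M] {p : N → M} (hp : IsCoveringMap p)
    (hiso : ∀ x : N, ∃ r > 0, ∀ y ∈ Metric.ball x r, ∀ z ∈ Metric.ball x r,
      dist (p y) (p z) = dist y z) :
    ∃ π : HypSpace → N,
      (∀ a, ∃ r > 0, ∀ b ∈ Metric.ball a r, ∀ c ∈ Metric.ball a r,
        dist (π b) (π c) = dist b c) ∧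
      (∀ a b, π a = π b → ∃ γ, b = h γ • a) ∧ ∀ γ a, π (h γ • a) = π a := by
  obtain ⟨s, hs, hdev, hsec⟩ := hD.exists_section hN hp hiso
  refine ⟨fun a => (s a).pt, fun a => ?_, fun a b hab => ?_, fun γ a => ?_⟩
  · obtain ⟨U, hU, hd⟩ := hD.eventually_dist_dev (s a)
    obtain ⟨r, hr, hsub⟩ := Metric.mem_nhds_iff.1 (hs.continuousAt hU)
    refine ⟨r, hr, fun b hb c hc => ?_⟩
    rw [← hd _ (hsub hb) _ (hsub hc), hdev, hdev]
  · have key : ∀ ξ η : UnivCover x₀, ξ.pt = η.pt → ∃ γ, dev D η = h γ • dev D ξ := by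
      rintro ⟨y, c⟩ ⟨y', c'⟩ hy
      obtain rfl : y = y' := hy
      refine ⟨FundamentalGroup.fromPath (c.trans c'.symm), ?_⟩
      have h1 := hequiv (FundamentalGroup.fromPath (c.trans c'.symm)) y c
      have h2 : (FundamentalGroup.toPath
          (FundamentalGroup.fromPath (c.trans c'.symm))).symm.trans c = c' := by
        change (c.trans c'.symm).symm.trans c = c'
        have h3 : (c.trans c'.symm).symm = c'.trans c.symm := by
          obtain ⟨δ, rfl⟩ := Path.Homotopic.Quotient.mk_surjective c
          obtain ⟨δ', rfl⟩ := Path.Homotopic.Quotient.mk_surjective c'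
          rw [← Path.Homotopic.Quotient.mk_symm, ← Path.Homotopic.Quotient.mk_symm,
            ← Path.Homotopic.Quotient.mk_trans, ← Path.Homotopic.Quotient.mk_trans,
            ← Path.Homotopic.Quotient.mk_symm, Path.trans_symm, Path.symm_symm]
        rw [h3, Path.Homotopic.Quotient.trans_assoc, Path.Homotopic.Quotient.symm_trans,
          Path.Homotopic.Quotient.trans_refl]
      rw [h2] at h1
      exact h1
    obtain ⟨γ, hγ⟩ := key (s a) (s b) hab
    rw [hdev, hdev] at hγ
    exact ⟨γ, hγ⟩
  · have h1 : dev D (⟨(s a).pt, (FundamentalGroup.toPath γ).symm.trans (s a).cls⟩ :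
        UnivCover x₀) = h γ • a := by
      conv_rhs => rw [← hdev a]
      exact hequiv γ _ _
    have h2 := congrArg pt (hsec ⟨(s a).pt, (FundamentalGroup.toPath γ).symm.trans (s a).cls⟩)
    rw [h1] at h2
    exact h2

end Uniformization

/-! ### Volume -/

section Volume

open MeasureTheory Set

/-- A local isometry that is at most `k`-to-one on an open set does not shrink its Hausdorff measure
by more than the factor `k`. -/
theorem hausdorffMeasure_le_mul_of_locally_isometric {X Y : Type*} [MetricSpace X] [MetricSpace Y]
    [MeasurableSpace X] [BorelSpace X] [MeasurableSpace Y] [BorelSpace Y] [PolishSpace X]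
    [Nonempty X] {q : X → Y}
    (hq : ∀ a, ∃ r > 0, ∀ b ∈ Metric.ball a r, ∀ c ∈ Metric.ball a r, dist (q b) (q c) = dist b c)
    {W : Set X} (hW : MeasurableSet W) {k : ℕ}
    (hk : ∀ (y : Y) (F : Finset X), (∀ a ∈ F, a ∈ W ∧ q a = y) → F.card ≤ k) {d : ℝ} (hd : 0 ≤ d) :
    μH[d] W ≤ k * μH[d] (univ : Set Y) := by
  choose r hr hiso using hq
  obtain ⟨s, hs, hcover⟩ := TopologicalSpace.countable_cover_nhds
    fun a => Metric.ball_mem_nhds a (hr a)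
  have hsne : s.Nonempty := by
    by_contra hne
    rw [not_nonempty_iff_eq_empty.1 hne] at hcover
    simp only [mem_empty_iff_false, iUnion_of_empty, iUnion_empty] at hcover
    exact empty_ne_univ hcover
  obtain ⟨f, rfl⟩ := hs.exists_eq_range hsne
  rw [biUnion_range] at hcover
  set U : ℕ → Set X := fun n => Metric.ball (f n) (r (f n)) with hU
  set V : ℕ → Set X := fun n => disjointed U n ∩ W with hV
  have hVmeas : ∀ n, MeasurableSet (V n) := fun n =>
    (MeasurableSet.disjointed (fun n => Metric.isOpen_ball.measurableSet) n).inter hW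
  have hVU : ∀ n, V n ⊆ U n := fun n => inter_subset_left.trans (disjointed_subset U n)
  have hdist : ∀ n, ∀ b ∈ V n, ∀ c ∈ V n, dist (q b) (q c) = dist b c := fun n b hb c hc =>
    hiso (f n) b (hVU n hb) c (hVU n hc)
  have hinj : ∀ n, InjOn q (V n) := fun n b hb c hc h => by
    rw [← dist_eq_zero, ← hdist n b hb c hc, h, dist_self]
  have hWV : W = ⋃ n, V n := by
    rw [hV, ← iUnion_inter, iUnion_disjointed, hcover, univ_inter]
  have hle : ∀ n, μH[d] (V n) ≤ μH[d] (q '' V n) := by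
    intro n
    have hlip : LipschitzOnWith 1 (Function.invFunOn q (V n)) (q '' V n) := by
      refine LipschitzOnWith.of_dist_le_mul ?_
      rintro _ ⟨b, hb, rfl⟩ _ ⟨c, hc, rfl⟩
      rw [(hinj n).leftInvOn_invFunOn hb, (hinj n).leftInvOn_invFunOn hc, hdist n b hb c hc]
      simp
    have h1 := hlip.hausdorffMeasure_image_le hd
    rw [(hinj n).invFunOn_image subset_rfl] at h1
    simpa using h1
  have himg : ∀ n, MeasurableSet (q '' V n) := fun n => by
    refine (hVmeas n).image_of_continuousOn_injOn ?_ (hinj n)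
    have : LipschitzOnWith 1 q (V n) := LipschitzOnWith.of_dist_le_mul fun b hb c hc => by
      simp [hdist n b hb c hc]
    exact this.continuousOn
  have hdisj : ∀ m n, ∀ a ∈ V m, a ∈ V n → m = n := fun m n a hm hn => by
    by_contra hne
    exact (disjoint_left.1 (disjoint_disjointed U hne)) hm.1 hn.1
  have hcount : ∀ y, ∑' n, (q '' V n).indicator (1 : Y → ℝ≥0∞) y ≤ k := by
    intro y
    rw [ENNReal.tsum_eq_iSup_sum]
    refine iSup_le fun F => ?_
    classical
    have h1 : ∑ n ∈ F, (q '' V n).indicator (1 : Y → ℝ≥0∞) y =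
        ((F.filter fun n => y ∈ q '' V n).card : ℝ≥0∞) := by
      simp [indicator_apply]
    rw [h1]
    have hpre : ∀ n, y ∈ q '' V n → ∃ a, a ∈ V n ∧ q a = y := fun n hn => hn
    choose! a ha haq using hpre
    have h2 : (F.filter fun n => y ∈ q '' V n).card =
        ((F.filter fun n => y ∈ q '' V n).image a).card := by
      refine (Finset.card_image_of_injOn ?_).symm
      intro m hm n hn hmn
      rw [Finset.mem_coe, Finset.mem_filter] at hm hn
      exact hdisj m n (a m) (ha m hm.2) (by rw [show a m = a n from hmn]; exact ha n hn.2)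
    rw [h2]
    refine Nat.cast_le.2 (hk y _ fun b hb => ?_)
    obtain ⟨n, hn, rfl⟩ := Finset.mem_image.1 hb
    rw [Finset.mem_filter] at hn
    exact ⟨(ha n hn.2).2, haq n hn.2⟩
  calc μH[d] W ≤ ∑' n, μH[d] (V n) := by
        conv_lhs => rw [hWV]
        exact measure_iUnion_le _
    _ ≤ ∑' n, μH[d] (q '' V n) := ENNReal.tsum_le_tsum hle
    _ = ∑' n, ∫⁻ y, (q '' V n).indicator 1 y ∂μH[d] := by
        simp_rw [lintegral_indicator_one (himg _)]
    _ = ∫⁻ y, ∑' n, (q '' V n).indicator 1 y ∂μH[d] :=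
        (lintegral_tsum fun n => (measurable_one.indicator (himg n)).aemeasurable).symm
    _ ≤ ∫⁻ _, k ∂μH[d] := lintegral_mono hcount
    _ = k * μH[d] (univ : Set Y) := by rw [lintegral_const]

namespace HypSpace

/-- Euclidean coordinates with values in the product of three lines. -/
def realCoords (p : HypSpace) : Fin 3 → ℝ := ![p.z.re, p.z.im, p.t]

/-- The map `realCoords` is Lipschitz on a ball, and the image of the ball is open in Euclidean space,
hence has positive Lebesgue measure. -/
theorem hausdorffMeasure_ball_pos (p : HypSpace) {r : ℝ} (hr : 0 < r) :
    0 < μH[3] (Metric.ball p r) := by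
  have hp := p.t_pos
  set m := 2 * p.t * Real.cosh r with hm
  -- the image of the ball under `realCoords` is open
  have hopen : IsOpen (realCoords '' Metric.ball p r) := by
    let w : (Fin 3 → ℝ) → ℂ × ℝ := fun v => (⟨v 0, v 1⟩, v 2)
    have hw : Continuous w := by
      have : Continuous fun v : Fin 3 → ℝ => (⟨v 0, v 1⟩ : ℂ) := by
        simp only [Complex.mk_eq_add_mul_I]
        fun_prop
      fun_prop
    have himage : realCoords '' Metric.ball p r = w ⁻¹' {q | 0 < q.2 ∧
        ‖q.1 - p.z‖ ^ 2 + (q.2 - p.t) ^ 2 - 2 * p.t * (Real.cosh r - 1) * q.2 < 0} := by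
      ext v
      constructor
      · rintro ⟨q, hq, rfl⟩
        exact ⟨q.t_pos, (dist_lt_iff hr).1 hq⟩
      · rintro ⟨h1, h2⟩
        refine ⟨⟨⟨v 0, v 1⟩, v 2, h1⟩, (dist_lt_iff hr).2 h2, ?_⟩
        ext i
        fin_cases i <;> rfl
    rw [himage]
    have hcont : Continuous fun q : ℂ × ℝ =>
        ‖q.1 - p.z‖ ^ 2 + (q.2 - p.t) ^ 2 - 2 * p.t * (Real.cosh r - 1) * q.2 := by fun_prop
    exact IsOpen.preimage hw (IsOpen.inter (isOpen_lt continuous_const continuous_snd)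
      (isOpen_lt hcont continuous_const))
  -- the map `realCoords` is Lipschitz on the ball
  have hlip : ∃ K, LipschitzOnWith K realCoords (Metric.ball p r) := by
    refine ⟨⟨m * Real.exp (2 * r), by positivity⟩, LipschitzOnWith.of_dist_le_mul ?_⟩
    intro u hu v hv
    have hut := u.t_pos
    have hvt := v.t_pos
    have hbound : ∀ q ∈ Metric.ball p r, q.t ≤ m := by
      intro q hq
      refine (t_le_of_dist q p).trans ?_
      have : Real.cosh (dist q p) ≤ Real.cosh r := by
        rw [Real.cosh_le_cosh, abs_of_nonneg dist_nonneg, abs_of_pos hr]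
        exact le_of_lt hq
      exact mul_le_mul_of_nonneg_left this (by positivity)
    have hE : √(‖u.z - v.z‖ ^ 2 + (u.t - v.t) ^ 2) ≤ m * Real.exp (2 * r) * dist u v := by
      have h1 := sinh_half_dist u v
      rw [dist_toEucl] at h1
      have hs : 0 < √(u.t * v.t) := Real.sqrt_pos.2 (by positivity)
      rw [eq_div_iff (by positivity)] at h1
      rw [← h1]
      have h2 : √(u.t * v.t) ≤ m := by
        rw [Real.sqrt_le_left (by positivity), sq]
        exact mul_le_mul (hbound u hu) (hbound v hv) hvt.le (by positivity)
      have h3 : dist u v < 2 * r := by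
        have := dist_triangle_right u v p
        have := Metric.mem_ball.1 hu
        have := Metric.mem_ball.1 hv
        linarith
      have h4 : Real.sinh (dist u v / 2) ≤ dist u v / 2 * Real.exp (2 * r) := by
        have hx : (0 : ℝ) ≤ dist u v / 2 := by positivity
        have h5 : Real.exp (dist u v / 2) ≤ Real.exp (2 * r) := Real.exp_le_exp.2 (by linarith)
        have h6 := Real.add_one_le_exp (-(2 * (dist u v / 2)))
        have h7 : Real.exp (-(2 * (dist u v / 2))) * Real.exp (dist u v / 2) =
            Real.exp (-(dist u v / 2)) := by
          rw [← Real.exp_add]; congr 1; ring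
        have h8 := Real.exp_pos (dist u v / 2)
        rw [Real.sinh_eq]
        nlinarith [mul_le_mul_of_nonneg_right h6 h8.le, mul_le_mul_of_nonneg_left h5 hx]
      calc Real.sinh (dist u v / 2) * (2 * √(u.t * v.t))
          ≤ (dist u v / 2 * Real.exp (2 * r)) * (2 * m) := by gcongr
        _ = _ := by ring
    refine le_trans ?_ hE
    rw [dist_pi_le_iff (Real.sqrt_nonneg _)]
    have hz1 := Complex.abs_re_le_norm (u.z - v.z)
    have hz2 := Complex.abs_im_le_norm (u.z - v.z)
    have hsq : ‖u.z - v.z‖ ≤ √(‖u.z - v.z‖ ^ 2 + (u.t - v.t) ^ 2) :=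
      Real.le_sqrt_of_sq_le (by nlinarith [sq_nonneg (u.t - v.t)])
    intro i
    fin_cases i
    · exact hz1.trans hsq
    · exact hz2.trans hsq
    · change |u.t - v.t| ≤ _
      refine Real.le_sqrt_of_sq_le ?_
      rw [sq_abs]
      nlinarith [sq_nonneg ‖u.z - v.z‖]
  obtain ⟨K, hK⟩ := hlip
  have h1 := hK.hausdorffMeasure_image_le (d := 3) (by norm_num)
  have h2 : (μH[3] : Measure (Fin 3 → ℝ)) = volume := by
    have := hausdorffMeasure_pi_real (ι := Fin 3)
    simpa using this
  have h3 : 0 < volume (realCoords '' Metric.ball p r) :=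
    hopen.measure_pos volume ⟨_, p, Metric.mem_ball_self hr, rfl⟩
  rw [h2] at h1
  refine pos_iff_ne_zero.2 fun h0 => ?_
  rw [h0, mul_zero] at h1
  exact absurd h3 (not_lt.2 h1)

theorem hausdorffMeasure_ball_eq (p q : HypSpace) (r d : ℝ) :
    μH[d] (Metric.ball p r) = μH[d] (Metric.ball q r) := by
  obtain ⟨g, rfl⟩ := exists_smul_eq p q
  have h := (IsometryEquiv.constSMul (X := HypSpace) g).hausdorffMeasure_image d (Metric.ball p r)
  rw [IsometryEquiv.image_ball] at h
  exact h.symm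

theorem hausdorffMeasure_iUnion_ball (x : ℕ → HypSpace) {r : ℝ} (hr : 0 < r)
    (hx : Pairwise fun m n => Disjoint (Metric.ball (x m) r) (Metric.ball (x n) r)) :
    μH[3] (⋃ n, Metric.ball (x n) r) = ∞ := by
  rw [measure_iUnion hx fun n => Metric.isOpen_ball.measurableSet]
  simp_rw [fun n => hausdorffMeasure_ball_eq (x n) (x 0) r 3]
  exact ENNReal.tsum_const_eq_top_of_ne_zero (hausdorffMeasure_ball_pos (x 0) hr).ne'

end HypSpace

end Volume

/-! ### The orientation-reversing isometry attached to a conjugation -/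

namespace HypSpace

/-- The reflection `(z, t) ↦ (conj z, t)`. -/
noncomputable def reflect (p : HypSpace) : HypSpace := ⟨conj p.z, p.t, p.t_pos⟩

@[simp] theorem reflect_reflect (p : HypSpace) : p.reflect.reflect = p := by
  ext1 <;> simp [reflect]

theorem dist_reflect (p q : HypSpace) : dist p.reflect q.reflect = dist p q := by
  have h : ‖conj p.z - conj q.z‖ = ‖p.z - q.z‖ := by rw [← map_sub, RCLike.norm_conj]
  rw [dist_def, dist_def]
  simp only [reflect, h]

theorem dist_reflect_left (p q : HypSpace) : dist p.reflect q = dist p q.reflect := by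
  rw [← dist_reflect, reflect_reflect]

theorem reflect_smul (g : SL(2, ℂ)) (p : HypSpace) : (g • p).reflect = slConj g • p.reflect := by
  have hentry : ∀ i j, (slConj g).1 i j = conj (g.1 i j) := fun i j => rfl
  have hden : den (slConj g) p.reflect = den g p := by
    simp only [den, hentry, reflect]
    rw [← map_mul, ← map_add, RCLike.norm_conj, RCLike.norm_conj]
  ext1
  · rw [smul_z, hden]
    simp only [reflect, smul_z, hentry, map_div₀, map_add, map_mul, map_pow, Complex.conj_ofReal]
  · rw [smul_t, hden]
    rfl

theorem reflect_smul' (g : PSL(2, ℂ)) (p : HypSpace) : (g • p).reflect = pslConj g • p.reflect := by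
  induction g using QuotientGroup.induction_on with
  | H g => exact reflect_smul g p

theorem reflect_pslConj_smul (g : PSL(2, ℂ)) (p : HypSpace) :
    (pslConj g • p).reflect = g • p.reflect := by
  have h := reflect_smul' g p.reflect
  rw [reflect_reflect] at h
  rw [← h, reflect_reflect]

theorem two_mul_t_mul_cosh_dist (p q : HypSpace) :
    2 * p.t * q.t * Real.cosh (dist p q) = ‖p.z - q.z‖ ^ 2 + p.t ^ 2 + q.t ^ 2 := by
  linarith [norm_sub_sq_add p q]

/-- The point at height `T` above the origin. -/
def above (T : ℝ) (hT : 0 < T) : HypSpace := ⟨0, T, hT⟩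

/-- For an orientation-reversing isometry `σ = reflect ∘ A` that does not fix `∞`, the geodesic
from `above T` to its image converges to the geodesic from `∞` to `σ ∞`, of which the point `y` in
the statement is the summit. -/
theorem exists_cosh_dist_above (A : SL(2, ℂ)) (hA : A.1 1 0 ≠ 0) :
    ∃ (y : HypSpace) (κ : ℝ) (G : HypSpace → ℝ), 0 < κ ∧ (∀ p, 0 ≤ G p) ∧
      ∀ (T : ℝ) (hT : 0 < T) (p : HypSpace),
        Real.cosh (dist p (above T hT)) + Real.cosh (dist p (A • above T hT).reflect) =
          κ * T * Real.cosh (dist p y) + G p / T := by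
  set c := A.1 1 0 with hc
  set a := A.1 0 0 with ha
  have hcpos : 0 < ‖c‖ := norm_pos_iff.2 hA
  let y : HypSpace := ⟨conj (a / c), 1 / ‖c‖, by positivity⟩
  let G : HypSpace → ℝ := fun p => (‖p.z‖ ^ 2 + p.t ^ 2) / (2 * p.t) +
    (‖(A⁻¹ • p.reflect).z‖ ^ 2 + (A⁻¹ • p.reflect).t ^ 2) / (2 * (A⁻¹ • p.reflect).t)
  have habove : ∀ (T : ℝ) (hT : 0 < T) (p : HypSpace), Real.cosh (dist p (above T hT)) =
      T / (2 * p.t) + (‖p.z‖ ^ 2 + p.t ^ 2) / (2 * p.t) / T := by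
    intro T hT p
    have hp := p.t_pos
    have h : 2 * p.t * T * Real.cosh (dist p (above T hT)) = ‖p.z‖ ^ 2 + p.t ^ 2 + T ^ 2 := by
      have h' := two_mul_t_mul_cosh_dist p (above T hT)
      rwa [show p.z - (above T hT).z = p.z from sub_zero _] at h'
    field_simp
    linarith
  refine ⟨y, ‖c‖, G, hcpos, fun p => ?_, fun T hT p => ?_⟩
  · have h1 := p.t_pos
    have h2 := (A⁻¹ • p.reflect).t_pos
    positivity
  have hp := p.t_pos
  have hq := (A⁻¹ • p.reflect).t_pos
  have h1 : dist p (A • above T hT).reflect = dist (A⁻¹ • p.reflect) (above T hT) := by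
    rw [← dist_reflect_left, ← dist_smul A (A⁻¹ • p.reflect), smul_inv_smul]
  have h2 : 1 / (A⁻¹ • p.reflect).t = (‖c‖ ^ 2 * ‖p.z - y.z‖ ^ 2 + ‖c‖ ^ 2 * p.t ^ 2) / p.t := by
    rw [smul_t]
    have hrow : (A⁻¹).1 1 0 = -c ∧ (A⁻¹).1 1 1 = a := by
      have : (A⁻¹).1 = A.1.adjugate := rfl
      rw [this, Matrix.adjugate_fin_two]
      exact ⟨rfl, rfl⟩
    have hnorm : ‖-c * conj p.z + a‖ = ‖c‖ * ‖p.z - y.z‖ := by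
      have : -c * conj p.z + a = -(c * conj (p.z - y.z)) := by
        simp only [y, map_sub, Complex.conj_conj]
        field_simp
        ring
      rw [this, norm_neg, norm_mul, RCLike.norm_conj]
    rw [one_div_div]
    congr 1
    simp only [den, hrow.1, hrow.2, reflect, hnorm, norm_neg, mul_pow]
  have h3 := two_mul_t_mul_cosh_dist p y
  have h4 : y.t = 1 / ‖c‖ := rfl
  rw [h4] at h3
  have h5 : ‖c‖ * Real.cosh (dist p y) = 1 / (2 * p.t) + 1 / (A⁻¹ • p.reflect).t / 2 := by
    rw [h2]
    field_simp at h3 ⊢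
    linarith
  have h6 : ‖c‖ * T * Real.cosh (dist p y) = T / (2 * p.t) + T / (2 * (A⁻¹ • p.reflect).t) := by
    rw [mul_right_comm, h5]
    ring
  rw [h1, habove, habove, h6]
  simp only [G]
  ring

/-- No orientation-reversing isometry fixes all the points at infinity. -/
theorem exists_conj_entry_ne_zero (A : SL(2, ℂ)) :
    ∃ B : SL(2, ℂ), ((slConj B)⁻¹ * A * B).1 1 0 ≠ 0 := by
  have hdet := A.2
  rw [Matrix.det_fin_two] at hdet
  have hentry : ∀ B : SL(2, ℂ), ((slConj B)⁻¹ * A * B).1 1 0 =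
      (-conj (B.1 1 0) * A.1 0 0 + conj (B.1 0 0) * A.1 1 0) * B.1 0 0 +
      (-conj (B.1 1 0) * A.1 0 1 + conj (B.1 0 0) * A.1 1 1) * B.1 1 0 := by
    intro B
    have h1 : ((slConj B)⁻¹).1 = (slConj B).1.adjugate := rfl
    have h2 : ∀ i j, (slConj B).1 i j = conj (B.1 i j) := fun i j => rfl
    have h3 : ((slConj B)⁻¹ * A * B).1 = ((slConj B)⁻¹).1 * A.1 * B.1 := by
      rw [Matrix.SpecialLinearGroup.coe_mul, Matrix.SpecialLinearGroup.coe_mul]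
    rw [h3, h1, Matrix.adjugate_fin_two]
    simp only [Matrix.mul_apply, Fin.sum_univ_two, h2, Matrix.of_apply, Matrix.cons_val',
      Matrix.cons_val_zero, Matrix.cons_val_one, Matrix.cons_val_fin_one]
  by_contra! hall
  have hall' : ∀ p q r s : ℂ, p * s - q * r = 1 → (-conj r * A.1 0 0 + conj p * A.1 1 0) * p +
      (-conj r * A.1 0 1 + conj p * A.1 1 1) * r = 0 := fun p q r s h =>
    (hentry ⟨!![p, q; r, s], by rw [Matrix.det_fin_two]; exact h⟩).symm.trans (hall _)
  have h1 := hall' 1 0 0 1 (by ring)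
  have h2 := hall' 0 (-1) 1 0 (by ring)
  have h3 := hall' 1 0 1 1 (by ring)
  have h4 := hall' 1 0 Complex.I 1 (by ring)
  simp at h1 h2 h3 h4
  rw [h1, h2] at hdet h3 h4
  have h5 : A.1 0 0 = A.1 1 1 := by linear_combination -h3
  have h6 : A.1 1 1 = 0 := by
    have : Complex.I * A.1 1 1 * 2 = 0 := by
      rw [h5] at h4
      linear_combination h4
    simpa using this
  rw [h6] at hdet
  simp at hdet

/-- A version of `exists_cosh_dist_above` for arbitrary `A`: the points `x T` converge to a point at
infinity that is moved by `reflect ∘ A`. -/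
theorem exists_cosh_dist_eq (A : SL(2, ℂ)) :
    ∃ (x : ℝ → HypSpace) (y : HypSpace) (κ : ℝ) (G : HypSpace → ℝ), 0 < κ ∧ (∀ p, 0 ≤ G p) ∧
      ∀ T : ℝ, 0 < T → ∀ p : HypSpace,
        Real.cosh (dist p (x T)) + Real.cosh (dist p (A • x T).reflect) =
          κ * T * Real.cosh (dist p y) + G p / T := by
  obtain ⟨B, hB⟩ := exists_conj_entry_ne_zero A
  obtain ⟨y, κ, G, hκ, hG, h⟩ := exists_cosh_dist_above _ hB
  refine ⟨fun T => if hT : 0 < T then B • above T hT else y, B • y, κ, fun p => G (B⁻¹ • p), hκ,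
    fun p => hG _, fun T hT p => ?_⟩
  have h1 := h T hT (B⁻¹ • p)
  have h2 : ∀ q : HypSpace, dist (B⁻¹ • p) q = dist p (B • q) := fun q => by
    rw [← dist_smul B, smul_inv_smul]
  have h3 : B • (((slConj B)⁻¹ * A * B) • above T hT).reflect = (A • B • above T hT).reflect := by
    rw [← reflect_reflect (B • _), reflect_smul, reflect_reflect, ← mul_smul, ← mul_smul,
      mul_assoc, mul_inv_cancel_left]
  rw [h2, h2, h2, h3] at h1
  simp only [dif_pos hT]
  exact h1

theorem _root_.Real.cosh_add_le_exp_mul_cosh {u v : ℝ} (hv : 0 ≤ v) :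
    Real.cosh (u + v) ≤ Real.exp v * Real.cosh u := by
  rw [Real.cosh_add, ← Real.cosh_add_sinh v]
  have := mul_le_mul_of_nonneg_right (Real.sinh_lt_cosh u).le (Real.sinh_nonneg_iff.2 hv)
  linarith

/-- An isometry that commutes with `σ = reflect ∘ A` and moves `x` by a small amount moves `σ x` by
the same amount, hence also moves the points of the geodesic between `x` and `σ x` by a small
amount. -/
theorem cosh_dist_smul_le {A : SL(2, ℂ)} {x y : HypSpace} {c e δ : ℝ} {G : HypSpace → ℝ}
    (hδ : 0 ≤ δ) (hG : ∀ p, 0 ≤ G p) (he : 0 < e)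
    (h : ∀ p : HypSpace, Real.cosh (dist p x) + Real.cosh (dist p (A • x).reflect) =
      c * Real.cosh (dist p y) + G p / e)
    {g : PSL(2, ℂ)} (hg : ∀ p : HypSpace, (A • g • p).reflect = g • (A • p).reflect)
    (hx : dist (g • x) x ≤ δ) :
    c * Real.cosh (dist (g • y) y) ≤ Real.exp δ * (c + G y / e) := by
  have key : ∀ q : HypSpace, dist (g • q) q ≤ δ →
      Real.cosh (dist (g • y) q) ≤ Real.exp δ * Real.cosh (dist y q) := by
    intro q hq
    refine le_trans ?_ (Real.cosh_add_le_exp_mul_cosh hδ)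
    rw [Real.cosh_le_cosh, abs_of_nonneg dist_nonneg, abs_of_nonneg (by positivity)]
    have := dist_triangle (g • y) (g • q) q
    rw [dist_smul_smul] at this
    linarith
  have h1 := key x hx
  have h2 := key (A • x).reflect (by
    rw [← hg, dist_reflect, dist_smul]
    exact hx)
  have h3 := h (g • y)
  have h4 := h y
  rw [dist_self, Real.cosh_zero, mul_one] at h4
  rw [← h4]
  have h5 : 0 ≤ G (g • y) / e := div_nonneg (hG _) he.le
  linarith

end HypSpace

/-! ### The centralizer of the holonomy of a manifold of finite volume -/

section Centralizer

open Set Filter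

variable {N : Type*} [MetricSpace N]

/-- The holonomy group acts freely and discretely: an element that moves `y` by a small amount acts
trivially. -/
theorem exists_smul_eq_self_of_dist_lt {Γ : Type*} {h : Γ → PSL(2, ℂ)} {π : HypSpace → N}
    (hiso : ∀ a, ∃ r > 0, ∀ b ∈ Metric.ball a r, ∀ c ∈ Metric.ball a r, dist (π b) (π c) = dist b c)
    (hπ : ∀ γ a, π (h γ • a) = π a) (y : HypSpace) :
    ∃ r > 0, ∀ γ, dist (h γ • y) y < r → ∀ a : HypSpace, h γ • a = a := by
  have hfix : ∀ u : HypSpace, ∃ r > 0, ∀ γ, ∀ v ∈ Metric.ball u r, h γ • v ∈ Metric.ball u r →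
      h γ • v = v := by
    intro u
    obtain ⟨r, hr, hd⟩ := hiso u
    refine ⟨r, hr, fun γ v hv hv' => ?_⟩
    rw [← dist_eq_zero, ← hd _ hv' _ hv, hπ, dist_self]
  obtain ⟨r, hr, hy⟩ := hfix y
  refine ⟨r, hr, fun γ hγ => ?_⟩
  have hcont : Continuous fun a : HypSpace => h γ • a :=
    (Isometry.of_dist_eq fun a b => HypSpace.dist_smul_smul (h γ) a b).continuous
  have hclopen : IsClopen {a : HypSpace | h γ • a = a} := by
    refine ⟨isClosed_eq hcont continuous_id, isOpen_iff_mem_nhds.2 fun u hu => ?_⟩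
    obtain ⟨s, hs, hfu⟩ := hfix u
    have hu' : h γ • u ∈ Metric.ball u s := by
      rw [show h γ • u = u from hu]
      exact Metric.mem_ball_self hs
    filter_upwards [Metric.ball_mem_nhds u hs,
      hcont.continuousAt (Metric.isOpen_ball.mem_nhds hu')] with v hv hv'
    exact hfu γ v hv hv'
  have huniv := hclopen.eq_univ ⟨y, hy γ y (Metric.mem_ball_self hr) hγ⟩
  exact fun a => huniv.ge (mem_univ a)

/-- In the situation of `HypSpace.exists_cosh_dist_eq`, an isometry that commutes with
`reflect ∘ A` and moves a point `z T` with `T` large by less than `2 * r` moves `y` by less than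
`ρ`. -/
theorem exists_dist_smul_lt {A : SL(2, ℂ)} {z : ℝ → HypSpace} {y : HypSpace} {κ : ℝ}
    {G : HypSpace → ℝ} (hκ : 0 < κ) (hG : ∀ p, 0 ≤ G p)
    (hz : ∀ T : ℝ, 0 < T → ∀ p : HypSpace,
      Real.cosh (dist p (z T)) + Real.cosh (dist p (A • z T).reflect) =
        κ * T * Real.cosh (dist p y) + G p / T) {ρ : ℝ} (hρ : 0 < ρ) :
    ∃ r T₀ : ℝ, 0 < r ∧ 1 ≤ T₀ ∧ ∀ T, T₀ ≤ T → ∀ g : PSL(2, ℂ),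
      (∀ p : HypSpace, (A • g • p).reflect = g • (A • p).reflect) →
      dist (g • z T) (z T) < 2 * r → dist (g • y) y < ρ := by
  -- the radius `r` and the height `T₀` are chosen such that `exp (2 * r) * (1 + ε) < cosh ρ`
  have hC : 1 < Real.cosh ρ := Real.one_lt_cosh.2 hρ.ne'
  set E := √(Real.cosh ρ) with hE
  have hE1 : 1 < E := Real.lt_sqrt_of_sq_lt (by linarith)
  have hEsq : E * E = Real.cosh ρ := Real.mul_self_sqrt (by linarith)
  set r := Real.log E / 2 with hr
  have hr0 : 0 < r := div_pos (Real.log_pos hE1) two_pos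
  have hexp : Real.exp (2 * r) = E := by
    rw [hr, mul_div_cancel₀ _ two_ne_zero, Real.exp_log (by linarith)]
  obtain ⟨T₀, hT₀1, hT₀⟩ : ∃ T₀ : ℝ, 1 ≤ T₀ ∧ G y < κ * (E - 1) * T₀ := by
    refine ⟨max 1 (G y / (κ * (E - 1)) + 1), le_max_left _ _, ?_⟩
    have hpos : 0 < κ * (E - 1) := mul_pos hκ (by linarith)
    have h1 : G y / (κ * (E - 1)) < max 1 (G y / (κ * (E - 1)) + 1) :=
      (lt_add_one _).trans_le (le_max_right _ _)
    rw [div_lt_iff₀ hpos] at h1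
    linarith
  refine ⟨r, T₀, hr0, hT₀1, ?_⟩
  intro T hT g hg hγ
  have hT1 : 1 ≤ T := hT₀1.trans hT
  have hT0 : 0 < T := by linarith
  have h1 := HypSpace.cosh_dist_smul_le (by linarith) hG hT0 (hz T hT0) hg hγ.le
  rw [hexp] at h1
  have h2 : G y / T < κ * T * (E - 1) := by
    rw [div_lt_iff₀ hT0]
    have h3 : κ * (E - 1) * T₀ ≤ κ * (E - 1) * T :=
      mul_le_mul_of_nonneg_left hT (mul_pos hκ (by linarith)).le
    have h4 : 0 ≤ κ * (E - 1) * T := by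
      have : 0 < E - 1 := by linarith
      positivity
    nlinarith [mul_le_mul_of_nonneg_left hT1 h4]
  have h3 : κ * T * Real.cosh (dist (g • y) y) < κ * T * Real.cosh ρ := by
    rw [← hEsq]
    refine h1.trans_lt ?_
    nlinarith
  have h4 := lt_of_mul_lt_mul_left h3 (by positivity)
  rw [Real.cosh_lt_cosh, abs_of_nonneg dist_nonneg, abs_of_pos hρ] at h4
  exact h4

/-- In the situation of `HypSpace.exists_cosh_dist_eq`, the displacement of `reflect ∘ A` is
unbounded on the points `z T`. -/
theorem exists_le_dist_reflect {A : SL(2, ℂ)} {z : ℝ → HypSpace} {y : HypSpace} {κ : ℝ}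
    {G : HypSpace → ℝ} (hκ : 0 < κ) (hG : ∀ p, 0 ≤ G p)
    (hz : ∀ T : ℝ, 0 < T → ∀ p : HypSpace,
      Real.cosh (dist p (z T)) + Real.cosh (dist p (A • z T).reflect) =
        κ * T * Real.cosh (dist p y) + G p / T) {T₀ : ℝ} (hT₀ : 1 ≤ T₀) (c : ℝ) :
    ∃ T, T₀ ≤ T ∧ c ≤ dist (z T) (A • z T).reflect := by
  refine ⟨max T₀ ((Real.cosh c + 1) / κ), le_max_left _ _, ?_⟩
  set T := max T₀ ((Real.cosh c + 1) / κ) with hT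
  have hT0 : 0 < T := by linarith [le_max_left T₀ ((Real.cosh c + 1) / κ)]
  have h1 := hz T hT0 (z T)
  rw [dist_self, Real.cosh_zero] at h1
  have h2 : Real.cosh c + 1 ≤ κ * T := by
    have := le_max_right T₀ ((Real.cosh c + 1) / κ)
    rw [← hT, div_le_iff₀ hκ] at this
    linarith
  have h3 := Real.one_le_cosh (dist (z T) y)
  have h4 : 0 ≤ G (z T) / T := div_nonneg (hG _) hT0.le
  have h5 : κ * T ≤ κ * T * Real.cosh (dist (z T) y) :=
    le_mul_of_one_le_right (by positivity) h3
  have h6 : Real.cosh c ≤ Real.cosh (dist (z T) (A • z T).reflect) := by linarith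
  rw [Real.cosh_le_cosh, abs_of_nonneg (dist_nonneg (x := z T))] at h6
  exact (le_abs_self c).trans h6

/-- A function that is unbounded above has values that are separated by gaps of a given size. -/
theorem exists_seq_add_le {α : Type*} {P : α → Prop} {F : α → ℝ}
    (h : ∀ c : ℝ, ∃ a, P a ∧ c ≤ F a) {c : ℝ} (hc : 0 ≤ c) :
    ∃ τ : ℕ → α, (∀ n, P (τ n)) ∧ ∀ m n, m < n → F (τ m) + c ≤ F (τ n) := by
  choose next hnext hF using h
  let τ : ℕ → α := fun n => n.rec (next 0) fun _ a => next (F a + c)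
  have hstep : ∀ n, F (τ n) + c ≤ F (τ (n + 1)) := fun n => hF _
  have hmono : Monotone fun n => F (τ n) :=
    monotone_nat_of_le_succ fun n => by linarith [hstep n]
  refine ⟨τ, fun n => ?_, fun m n hmn => (hstep m).trans (hmono (Nat.succ_le_of_lt hmn))⟩
  cases n with
  | zero => exact hnext _
  | succ n => exact hnext _

/-- If an orientation-reversing isometry commutes with the holonomy group, there are infinitely
many disjoint balls of a fixed radius that embed disjointly in the quotient. The displacement of
the isometry descends to the quotient and separates the balls. -/
theorem exists_disjoint_embedded_balls {Γ : Type*} {h : Γ → PSL(2, ℂ)} {π : HypSpace → N}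
    (hiso : ∀ a, ∃ r > 0, ∀ b ∈ Metric.ball a r, ∀ c ∈ Metric.ball a r, dist (π b) (π c) = dist b c)
    (hfib : ∀ a b, π a = π b → ∃ γ, b = h γ • a) (hπ : ∀ γ a, π (h γ • a) = π a) {A : SL(2, ℂ)}
    (hA : ∀ γ (a : HypSpace), (A • h γ • a).reflect = h γ • (A • a).reflect) :
    ∃ (x : ℕ → HypSpace) (r : ℝ), 0 < r ∧
      (Pairwise fun m n => Disjoint (Metric.ball (x m) r) (Metric.ball (x n) r)) ∧
      InjOn π (⋃ n, Metric.ball (x n) r) := by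
  obtain ⟨z, y, κ, G, hκ, hG, hz⟩ := HypSpace.exists_cosh_dist_eq A
  obtain ⟨ρ, hρ, hρy⟩ := exists_smul_eq_self_of_dist_lt hiso hπ y
  set f : HypSpace → ℝ := fun a => dist a (A • a).reflect with hf
  have hfh : ∀ γ a, f (h γ • a) = f a := fun γ a => by
    simp only [hf]
    rw [hA, HypSpace.dist_smul_smul]
  have hflip : ∀ a b, f a ≤ f b + 2 * dist a b := fun a b => by
    have h1 := dist_triangle4 a b (A • b).reflect (A • a).reflect
    rw [HypSpace.dist_reflect, dist_smul, dist_comm b a] at h1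
    simp only [hf]
    linarith
  obtain ⟨r, T₀, hr0, hT₀, hsmall⟩ := exists_dist_smul_lt hκ hG hz hρ
  have hunb : ∀ c : ℝ, ∃ T, T₀ ≤ T ∧ c ≤ f (z T) := exists_le_dist_reflect hκ hG hz hT₀
  obtain ⟨τ, hτ, hgap⟩ := exists_seq_add_le (F := fun T => f (z T)) hunb (c := 4 * r) (by linarith)
  have hnear : ∀ m n a b, a ∈ Metric.ball (z (τ m)) r → b ∈ Metric.ball (z (τ n)) r →
      f a = f b → m = n := by
    have hlt : ∀ m n a b, a ∈ Metric.ball (z (τ m)) r → b ∈ Metric.ball (z (τ n)) r →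
        f a = f b → ¬ m < n := by
      intro m n a b ha hb hab hmn
      have h1 := hgap m n hmn
      have h2 := hflip a (z (τ m))
      have h3 := hflip (z (τ n)) b
      rw [Metric.mem_ball] at ha
      rw [Metric.mem_ball'] at hb
      linarith
    intro m n a b ha hb hab
    exact le_antisymm (not_lt.1 (hlt n m b a hb ha hab.symm)) (not_lt.1 (hlt m n a b ha hb hab))
  refine ⟨fun n => z (τ n), r, hr0, fun m n hmn => ?_, ?_⟩
  · exact disjoint_left.2 fun a ha hb => hmn (hnear m n a a ha hb rfl)
  · intro a ha b hb hab
    obtain ⟨m, ha⟩ := mem_iUnion.1 ha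
    obtain ⟨n, hb⟩ := mem_iUnion.1 hb
    obtain ⟨γ, rfl⟩ := hfib a b hab
    obtain rfl := hnear m n _ _ ha hb (hfh γ a).symm
    refine (hρy γ (hsmall (τ m) (hτ m) (h γ) (hA γ) ?_) a).symm
    have h1 := dist_triangle (h γ • z (τ m)) (h γ • a) (z (τ m))
    rw [HypSpace.dist_smul_smul] at h1
    rw [Metric.mem_ball'] at ha
    rw [Metric.mem_ball] at hb
    linarith

end Centralizer

theorem mainTheorem9 {M : Type*} [MetricSpace M] [MeasurableSpace M] [BorelSpace M]
    [CompleteSpace M] [ConnectedSpace M]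
    (hM : IsHypThreeManifold M) (hvol : HasFiniteVolume M) (hnonor : ¬ IsHypOrientable M)
    {N : Type*} [MetricSpace N] (p : N → M) (hp : IsOrientationCovering p)
    (x₀ : N) (h : FundamentalGroup N x₀ →* PSL(2, ℂ)) (hh : IsOrientedHolonomy x₀ h) :
    RepClasses.mk h ≠ RepClasses.mk (pslConj.comp h) := by
  intro heq
  obtain ⟨A, hA⟩ : ∃ A : PSL(2, ℂ), ∀ γ, A * h γ * A⁻¹ = (pslConj.comp h) γ := Quotient.exact heq
  obtain ⟨A, rfl⟩ := QuotientGroup.mk_surjective A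
  obtain ⟨D, hD, hequiv⟩ := hh
  obtain ⟨π, hπiso, hfib, hπ⟩ := hD.exists_uniformization
    hp.orientable.isHypThreeManifold hequiv hp.isCoveringMap hp.locally_isometric
  -- the isometry `reflect ∘ A` commutes with the holonomy group
  have hcomm : ∀ γ (a : HypSpace), (A • h γ • a).reflect = h γ • (A • a).reflect := by
    intro γ a
    have h1 : A • h γ • a = pslConj (h γ) • A • a := by
      have h2 := hA γ
      rw [mul_inv_eq_iff_eq_mul] at h2
      have h3 := congrArg (fun g : PSL(2, ℂ) => g • a) h2
      simp only [mul_smul] at h3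
      exact h3
    rw [h1, HypSpace.reflect_pslConj_smul]
  obtain ⟨x, r, hr, hdisj, hinj⟩ := exists_disjoint_embedded_balls hπiso hfib hπ hcomm
  have hπcont : Continuous π := by
    rw [continuous_iff_continuousAt]
    intro a
    obtain ⟨ρ, hρ, hd⟩ := hπiso a
    rw [ContinuousAt, tendsto_iff_dist_tendsto_zero]
    have h1 : Filter.Tendsto (fun b => dist b a) (𝓝 a) (𝓝 0) :=
      tendsto_iff_dist_tendsto_zero.1 Filter.tendsto_id
    refine h1.congr' ?_
    filter_upwards [Metric.ball_mem_nhds a hρ] with b hb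
    exact (hd b hb a (Metric.mem_ball_self hρ)).symm
  have hqiso : ∀ a, ∃ s > 0, ∀ b ∈ Metric.ball a s, ∀ c ∈ Metric.ball a s,
      dist (p (π b)) (p (π c)) = dist b c := by
    intro a
    obtain ⟨ρ, hρ, hd⟩ := hπiso a
    obtain ⟨ρ', hρ', hd'⟩ := hp.locally_isometric (π a)
    obtain ⟨s, hs, hsub⟩ := Metric.mem_nhds_iff.1 (Filter.inter_mem (Metric.ball_mem_nhds a hρ)
      (hπcont.continuousAt (Metric.ball_mem_nhds (π a) hρ')))
    refine ⟨s, hs, fun b hb c hc => ?_⟩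
    rw [hd' _ (hsub hb).2 _ (hsub hc).2, hd _ (hsub hb).1 _ (hsub hc).1]
  have hvolume := hausdorffMeasure_le_mul_of_locally_isometric (q := fun a => p (π a)) hqiso
    (W := ⋃ n, Metric.ball (x n) r)
    (MeasurableSet.iUnion fun n => Metric.isOpen_ball.measurableSet) (k := 2) (d := 3) ?_
    (by norm_num)
  · rw [HypSpace.hausdorffMeasure_iUnion_ball x hr hdisj] at hvolume
    exact (ENNReal.mul_lt_top (by simp) hvol).not_ge hvolume
  · intro m F hF
    classical
    have hcard := hp.two_sheeted m
    rw [← Finset.card_image_of_injOn (s := F) (f := π)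
      (hinj.mono fun a ha => (hF a ha).1), ← hcard, ← Set.ncard_coe_finset]
    refine Set.ncard_le_ncard ?_ (Set.finite_of_ncard_ne_zero (by rw [hcard]; norm_num))
    intro b hb
    obtain ⟨a, ha, rfl⟩ := Finset.mem_image.1 (Finset.mem_coe.1 hb)
    exact (hF a ha).2
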